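/- Let $X$ be a connected, weakly special cube complex, that is, a non-positively curved cube complex (the link of every vertex is a flag simplicial complex) in which no hyperplane self-intersects (no two distinct edges dual to the same hyperplane form the corner of a square at a common vertex) or self-osculates (no two distinct edges dual to the same hyperplane share a vertex at which they do not form the corner of a square, and no edge has both its ends at the same vertex). Let $p:\widetilde X\to X$ be the universal cover, and let $G=\pi_1(X)$ act on $\widetilde X$ by deck transformations. For a subcomplex $\widetilde Z\subset\widetilde X$ write $G_{\widetilde Z}=\{g\in G : g\widetilde Z=\widetilde Z\}$. Let $A,B\subset X$ be locally convex subcomplexes, i.e. at each vertex of $A$ the link in $A$ is a full subcomplex of the link in $X$, and likewise for $B$. Let $\widetilde A,\widetilde B\subset\widetilde X$ be elevations of $A$ and $B$, i.e. connected components of $p^{-1}(A)$ and $p^{-1}(B)$ respectively. Let $\Pi_{\widetilde A}:\widetilde X\to\widetilde A$ be the projection, i.e. the combinatorial map that sends each vertex of $\widetilde X$ to the unique vertex of $\widetilde A$ closest to it in the combinatorial (edge-path) metric of $\widetilde X$, and let $\widetilde C=\Pi_{\widetilde A}(\widetilde B)$. Then $$G_{\widetilde C}=G_{\widetilde A}\cap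 G_{\widetilde B},$$ and the natural map $\widetilde C/G_{\widetilde C}\to X$ induced by $p$ is an embedding of cube complexes (it is injective). -/

import Mathlib

universe u v

/-- Isometric embeddings of the vertex set of the `m`-cube into the vertex set of the `n`-cube
(both with the Hamming distance). These are exactly the isometries of `[0,1]^m` onto the
`m`-dimensional faces of `[0,1]^n`. -/
structure CubeMap (m n : ℕ) where
  toFun : (Fin m → Bool) → (Fin n → Bool)
  isometry' : ∀ x y, hammingDist (toFun x) (toFun y) = hammingDist x y

namespace CubeMap

def id (n : ℕ) : CubeMap n n := ⟨fun x => x, fun _ _ => rfl⟩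

def comp {k m n : ℕ} (g : CubeMap m n) (f : CubeMap k m) : CubeMap k n :=
  ⟨fun x => g.toFun (f.toFun x), fun x y => by rw [g.isometry', f.isometry']⟩

/-- The inclusion of the vertex `v` in the `n`-cube. -/
def vertex {n : ℕ} (v : Fin n → Bool) : CubeMap 0 n :=
  ⟨fun _ => v, fun x y => by rw [Subsingleton.elim x y, hammingDist_self, hammingDist_self]⟩

/-- The edge of the `n`-cube through the vertex `v` in the `i`-th coordinate direction,
directed from coordinate `0` to coordinate `1`. -/
def edge {n : ℕ} (v : Fin n → Bool) (i : Fin n) : CubeMap 1 n :=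
  ⟨fun x => Function.update v i (x 0), fun x y => by
    by_cases h : x 0 = y 0
    · have hxy : x = y := funext fun j => by rw [Subsingleton.elim j 0, h]
      rw [hxy, hammingDist_self, hammingDist_self]
    · have h1 : (Finset.univ.filter fun j =>
          Function.update v i (x 0) j ≠ Function.update v i (y 0) j) = {i} := by
        ext j
        by_cases hj : j = i
        · subst hj; simp [h]
        · simp [hj]
      have h2 : (Finset.univ.filter fun j => x j ≠ y j) = {0} := by
        ext j
        rw [Subsingleton.elim j 0]; simp [h]
      simp only [hammingDist, h1, h2, Finset.card_singleton]⟩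

/-- The reflection of the `1`-cube. -/
def reflect : CubeMap 1 1 :=
  ⟨fun x i => !(x i), fun x y => by
    simp only [hammingDist, ne_eq, Bool.not_inj_iff]⟩

end CubeMap

/-- A cube complex, given by its characteristic maps: `Cell n` is the set of the parametrized
`n`-cubes (each `n`-cube occurs once for each of its `2^n n!` parametrizations by `[0,1]^n`), and
`face f c` is the restriction of the parametrized cube `c` along the isometry `f` onto a face.
The condition `free` says that different parametrizations of a cube are different, so that a cube
is never glued to itself along its interior. In particular `Cell 0` is the set of vertices and
`Cell 1` the set of oriented edges. -/
structure CubeComplex where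
  Cell : ℕ → Type u
  face : ∀ {m n : ℕ}, CubeMap m n → Cell n → Cell m
  face_id : ∀ {n : ℕ} (c : Cell n), face (CubeMap.id n) c = c
  face_comp : ∀ {k m n : ℕ} (g : CubeMap m n) (f : CubeMap k m) (c : Cell n),
    face (g.comp f) c = face f (face g c)
  free : ∀ {n : ℕ} (s : CubeMap n n) (c : Cell n), face s c = c → s = CubeMap.id n

namespace CubeComplex

section Basic

variable (X : CubeComplex.{u})

/-- The vertex of the parametrized cube `c` at the corner `v`. -/
def vertex {n : ℕ} (c : X.Cell n) (v : Fin n → Bool) : X.Cell 0 :=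
  X.face (CubeMap.vertex v) c

/-- The oriented edge of the parametrized cube `c` through the corner `v` in direction `i`. -/
def edge {n : ℕ} (c : X.Cell n) (v : Fin n → Bool) (i : Fin n) : X.Cell 1 :=
  X.face (CubeMap.edge v i) c

/-- The corner of `c` at which the parametrization starts; by reparametrizing, every
corner of every cube is of this form. -/
def corner {n : ℕ} (c : X.Cell n) : X.Cell 0 := X.vertex c (fun _ => false)

/-- The oriented edges of `c` that start at its corner. -/
def cornerEdge {n : ℕ} (c : X.Cell n) (i : Fin n) : X.Cell 1 := X.edge c (fun _ => false) i

/-- The initial vertex of an oriented edge. -/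
def source (e : X.Cell 1) : X.Cell 0 := X.vertex e (fun _ => false)

/-- The terminal vertex of an oriented edge. -/
def target (e : X.Cell 1) : X.Cell 0 := X.vertex e (fun _ => true)

/-- The same edge with the opposite orientation. -/
def flip (e : X.Cell 1) : X.Cell 1 := X.face CubeMap.reflect e

/-- `l` is an edge path from `x` to `y`. -/
def IsPath : X.Cell 0 → List (X.Cell 1) → X.Cell 0 → Prop
  | x, [], y => x = y
  | x, e :: l, y => X.source e = x ∧ IsPath (X.target e) l y

def Connected : Prop :=
  Nonempty (X.Cell 0) ∧ ∀ x y : X.Cell 0, ∃ l, X.IsPath x l y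

/-- The combinatorial metric on the vertices: the least length of an edge path. -/
noncomputable def dist (x y : X.Cell 0) : ℕ :=
  sInf {k : ℕ | ∃ l, X.IsPath x l y ∧ l.length = k}

/-- Elementary homotopies of edge paths: inserting a backtrack, or pushing two consecutive edges
across a square. -/
inductive HomotopyStep : List (X.Cell 1) → List (X.Cell 1) → Prop
  | backtrack (l₁ : List (X.Cell 1)) (e : X.Cell 1) (l₂ : List (X.Cell 1)) :
      HomotopyStep (l₁ ++ l₂) (l₁ ++ e :: X.flip e :: l₂)
  | square (l₁ : List (X.Cell 1)) (s : X.Cell 2) (l₂ : List (X.Cell 1)) :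
      HomotopyStep
        (l₁ ++ X.edge s ![false, false] 0 :: X.edge s ![true, false] 1 :: l₂)
        (l₁ ++ X.edge s ![false, false] 1 :: X.edge s ![false, true] 0 :: l₂)

/-- Homotopy of edge paths from `x` to `y`, through edge paths from `x` to `y`. -/
def Homotopic (x y : X.Cell 0) : List (X.Cell 1) → List (X.Cell 1) → Prop :=
  Relation.EqvGen fun l l' => X.IsPath x l y ∧ X.IsPath x l' y ∧ X.HomotopyStep l l'

/-- Connected, with trivial edge-path fundamental group. -/
def SimplyConnected : Prop :=
  X.Connected ∧ ∀ (x : X.Cell 0) (l : List (X.Cell 1)), X.IsPath x l x → X.Homotopic x x l []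

/-- The oriented edges `e`, `f` form the corner of a square at their common initial vertex. -/
def FormCorner (e f : X.Cell 1) : Prop :=
  ∃ s : X.Cell 2, X.cornerEdge s 0 = e ∧ X.cornerEdge s 1 = f

/-- Non-positive curvature: the link of every vertex `x` is a flag simplicial complex. The vertices
of the link are the oriented edges starting at `x`; its `(n-1)`-simplices are the `n`-cubes with a
chosen corner at `x`. The first two fields say that the link is a simplicial complex (the vertices
of a simplex are distinct, and they determine the simplex), the third that it is flag. -/
structure NonPositivelyCurved : Prop where
  cornerEdge_injective : ∀ {n : ℕ} (c : X.Cell n), Function.Injective (X.cornerEdge c)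
  eq_of_cornerEdge : ∀ {n : ℕ} (c c' : X.Cell n), X.corner c = X.corner c' →
    (∀ i, X.cornerEdge c i = X.cornerEdge c' i) → c = c'
  flag : ∀ {n : ℕ} (x : X.Cell 0) (e : Fin n → X.Cell 1), Function.Injective e →
    (∀ i, X.source (e i) = x) → (∀ i j, i ≠ j → X.FormCorner (e i) (e j)) →
    ∃ c : X.Cell n, X.corner c = x ∧ ∀ i, X.cornerEdge c i = e i

/-- `e` and `f` are the two orientations of an edge, or (consistently oriented) opposite edges of
a square. -/
def ElementaryParallel (e f : X.Cell 1) : Prop :=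
  f = X.flip e ∨ ∃ s : X.Cell 2, e = X.edge s ![false, false] 0 ∧ f = X.edge s ![false, true] 0

/-- Hyperplanes, as the classes of the equivalence relation on (unoriented) edges that is generated
by being opposite edges of a square. -/
def Hyperplane : Type u := Quot X.ElementaryParallel

/-- The hyperplane dual to an edge. -/
def dualHyperplane (e : X.Cell 1) : X.Hyperplane := Quot.mk _ e

/-- Two distinct edges dual to `H` form the corner of a square at some vertex. -/
def SelfIntersects (H : X.Hyperplane) : Prop :=
  ∃ e f : X.Cell 1, X.source e = X.source f ∧ e ≠ f ∧ e ≠ X.flip f ∧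
    X.dualHyperplane e = H ∧ X.dualHyperplane f = H ∧ X.FormCorner e f

/-- Two distinct edges dual to `H` share a vertex at which they do not form the corner of a square,
or some edge dual to `H` has both ends at the same vertex. -/
def SelfOsculates (H : X.Hyperplane) : Prop :=
  (∃ e f : X.Cell 1, X.source e = X.source f ∧ e ≠ f ∧ e ≠ X.flip f ∧
    X.dualHyperplane e = H ∧ X.dualHyperplane f = H ∧ ¬ X.FormCorner e f) ∨
  ∃ e : X.Cell 1, X.dualHyperplane e = H ∧ X.source e = X.target e

structure WeaklySpecial : Prop where
  nonPositivelyCurved : X.NonPositivelyCurved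
  not_selfIntersects : ∀ H : X.Hyperplane, ¬ X.SelfIntersects H
  not_selfOsculates : ∀ H : X.Hyperplane, ¬ X.SelfOsculates H

end Basic

/-- Combinatorial maps: they send `n`-cubes to `n`-cubes by isometries, compatibly with faces. -/
structure Hom (X : CubeComplex.{u}) (Y : CubeComplex.{v}) where
  map : ∀ {n : ℕ}, X.Cell n → Y.Cell n
  map_face : ∀ {m n : ℕ} (f : CubeMap m n) (c : X.Cell n), map (X.face f c) = Y.face f (map c)

/-- A combinatorial map is an embedding if it is injective on cubes. -/
def Hom.IsEmbedding {X : CubeComplex.{u}} {Y : CubeComplex.{v}} (p : Hom X Y) : Prop :=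
  ∀ n : ℕ, Function.Injective (p.map : X.Cell n → Y.Cell n)

/-- Covering maps: at every vertex, the cubes with a corner there correspond bijectively to the
cubes with a corner at the image vertex (for nonempty `X` and connected `Y` such a map is
automatically surjective). -/
def Hom.IsCovering {X : CubeComplex.{u}} {Y : CubeComplex.{v}} (p : Hom X Y) : Prop :=
  ∀ (n : ℕ) (x : X.Cell 0) (c : Y.Cell n), Y.corner c = p.map x →
    ∃! d : X.Cell n, X.corner d = x ∧ p.map d = c

/-- `p` is a universal cover of the connected cube complex `Y`. -/
structure Hom.IsUniversalCover {X : CubeComplex.{u}} {Y : CubeComplex.{v}} (p : Hom X Y) :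
    Prop where
  isCovering : p.IsCovering
  simplyConnected : X.SimplyConnected

/-- The group of deck transformations of `p`: families of permutations of the parametrized
`n`-cubes that commute with faces and with `p`. -/
def Hom.deck {X : CubeComplex.{u}} {Y : CubeComplex.{v}} (p : Hom X Y) :
    Subgroup (∀ n : ℕ, Equiv.Perm (X.Cell n)) where
  carrier := {g | (∀ {m n : ℕ} (f : CubeMap m n) (c : X.Cell n),
      g m (X.face f c) = X.face f (g n c)) ∧ ∀ {n : ℕ} (c : X.Cell n), p.map (g n c) = p.map c}
  one_mem' := ⟨fun _ _ => rfl, fun _ => rfl⟩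
  mul_mem' := by
    rintro a b ⟨ha, ha'⟩ ⟨hb, hb'⟩
    exact ⟨fun f c => by simp [Pi.mul_apply, Equiv.Perm.mul_apply, hb, ha],
      fun c => by simp [Pi.mul_apply, Equiv.Perm.mul_apply, hb', ha']⟩
  inv_mem' := by
    rintro a ⟨ha, ha'⟩
    refine ⟨fun f c => ?_, fun c => ?_⟩
    · rw [Pi.inv_apply, Pi.inv_apply, Equiv.Perm.inv_eq_iff_eq, ha]
      simp
    · rw [← ha', Pi.inv_apply]
      simp

/-- A subcomplex: a set of cubes closed under faces (and under reparametrization). -/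
structure Subcomplex (X : CubeComplex.{u}) where
  cells : ∀ n : ℕ, Set (X.Cell n)
  face_mem : ∀ {m n : ℕ} (f : CubeMap m n) {c : X.Cell n}, c ∈ cells n → X.face f c ∈ cells m

namespace Subcomplex

variable {X : CubeComplex.{u}} {Y : CubeComplex.{v}}

/-- At each vertex of `A`, the link in `A` is a full subcomplex of the link in `X`: a cube with a
corner in `A` all of whose edges at that corner lie in `A` lies in `A`. -/
def LocallyConvex (A : X.Subcomplex) : Prop :=
  ∀ {n : ℕ} (c : X.Cell n), X.corner c ∈ A.cells 0 → (∀ i, X.cornerEdge c i ∈ A.cells 1) →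
    c ∈ A.cells n

/-- The preimage of a subcomplex under a combinatorial map. -/
def preimage (p : Hom X Y) (A : Y.Subcomplex) : X.Subcomplex where
  cells n := {c | p.map c ∈ A.cells n}
  face_mem {m n} f c hc := by
    change p.map (X.face f c) ∈ A.cells m
    rw [p.map_face]
    exact A.face_mem f hc

/-- The component of the subcomplex `A` that contains the vertex `x`: all cubes of `A` whose
vertices can be joined to `x` by an edge path in `A`. -/
def component (A : X.Subcomplex) (x : X.Cell 0) : X.Subcomplex where
  cells n := {c | c ∈ A.cells n ∧
    ∀ v, ∃ l, X.IsPath x l (X.vertex c v) ∧ ∀ e ∈ l, e ∈ A.cells 1}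
  face_mem f c hc := by
    refine ⟨A.face_mem f hc.1, fun v => ?_⟩
    have h : X.vertex (X.face f c) v = X.vertex c (f.toFun v) := by
      unfold vertex
      rw [← X.face_comp]
      rfl
    rw [h]
    exact hc.2 _

/-- `A'` is an elevation of `A` along `p`: a connected component of the preimage of `A`. -/
def IsElevation (p : Hom X Y) (A : Y.Subcomplex) (A' : X.Subcomplex) : Prop :=
  ∃ x ∈ (preimage p A).cells 0, A' = (preimage p A).component x

/-- `y` is the unique vertex of `A` closest to `x` in the combinatorial metric, that is,
the projection of the vertex `x` to `A` is `y`. -/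
def IsProjection (A : X.Subcomplex) (x y : X.Cell 0) : Prop :=
  y ∈ A.cells 0 ∧ ∀ z ∈ A.cells 0, z ≠ y → X.dist x y < X.dist x z

/-- The image of the subcomplex `B` under the projection to `A`: the cubes of `A` onto which the
projection maps some cube of `B`, vertex by vertex. (The projection collapses a cube of `B`
along some of its coordinate directions; as then the faces in the remaining directions have the same
image, cubes of `B` of the same dimension as the image suffice.) -/
def projection (A B : X.Subcomplex) : X.Subcomplex where
  cells n := {c | c ∈ A.cells n ∧
    ∃ b ∈ B.cells n, ∀ v, A.IsProjection (X.vertex b v) (X.vertex c v)}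
  face_mem f c hc := by
    obtain ⟨hA, b, hb, h⟩ := hc
    refine ⟨A.face_mem f hA, X.face f b, B.face_mem f hb, fun v => ?_⟩
    have h' : ∀ d, X.vertex (X.face f d) v = X.vertex d (f.toFun v) := fun d => by
      unfold vertex
      rw [← X.face_comp]
      rfl
    rw [h', h']
    exact h _

/-- The stabilizer of a subcomplex in the group of deck transformations. -/
def stabilizer (p : Hom X Y) (C : X.Subcomplex) : Subgroup p.deck where
  carrier := {g | ∀ (n : ℕ) (c : X.Cell n), g.1 n c ∈ C.cells n ↔ c ∈ C.cells n}
  one_mem' := fun _ _ => Iff.rfl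
  mul_mem' := fun {a b} ha hb n c => (ha n (b.1 n c)).trans (hb n c)
  inv_mem' := fun {a} ha n c => by
    rw [← ha]
    simp

/-- Two cubes of `C` are in the same orbit of the stabilizer of `C`. -/
def SameOrbit (p : Hom X Y) (C : X.Subcomplex) (n : ℕ) (c d : C.cells n) : Prop :=
  ∃ g ∈ stabilizer p C, g.1 n c.1 = d.1

/-- The quotient of the subcomplex `C` by its stabilizer. -/
def quotient (p : Hom X Y) (C : X.Subcomplex) : CubeComplex.{u} where
  Cell n := Quot (SameOrbit p C n)
  face f := Quot.map (fun c => ⟨X.face f c.1, C.face_mem f c.2⟩) (by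
    rintro c d ⟨g, hg, h⟩
    exact ⟨g, hg, by rw [g.2.1, h]⟩)
  face_id := by
    rintro n ⟨c⟩
    exact congrArg (Quot.mk _) (Subtype.ext (X.face_id c.1))
  face_comp := by
    rintro k m n g f ⟨c⟩
    exact congrArg (Quot.mk _) (Subtype.ext (X.face_comp g f c.1))
  free := by
    rintro n s ⟨c⟩ h
    have h' := congrArg (Quot.lift (fun c : C.cells n => p.map c.1) (by
      rintro c d ⟨g, -, h⟩
      rw [← h, g.2.2])) h
    change p.map (X.face s c.1) = p.map c.1 at h'
    rw [p.map_face] at h'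
    exact Y.free s _ h'

/-- The combinatorial map from the quotient of `C` by its stabilizer to the base of the cover. -/
def quotientMap (p : Hom X Y) (C : X.Subcomplex) : Hom (C.quotient p) Y where
  map := Quot.lift (fun c => p.map c.1) (by
    rintro c d ⟨g, -, h⟩
    rw [← h, g.2.2])
  map_face := by
    rintro m n f ⟨c⟩
    exact p.map_face f c.1

end Subcomplex

end CubeComplex

/-!
Label every oriented edge of the universal cover `U` by the hyperplane of `X` dual to its image.
As hyperplanes of `X` neither self-intersect nor self-osculate, a vertex of `U` has at most one
edge with a given label, so a walk in `U` is determined by its start and the word of its labels;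
opposite edges of a square carry the same label. Deck transformations preserve labels.

Let `c` and `d` be vertices of the projection `C` of `B'` to `A'`. The main point
(`exists_common_walk`) is that a single word `w` leads both from `c` and from `d` into `B'`: it
labels the bridge from `A'` to `B'`, which crosses exactly the hyperplanes that separate `A'` from
`B'`. So if a deck transformation `g` moves `c` to `d`, it moves the end of one bridge, a vertex
of `B'`, to the end of the other one, again a vertex of `B'`. Since `A'` and `B'` are elevations,
`g` preserves both of them (`mem_stabilizer_of_isProjection`). This gives the inclusion of
stabilizers that is not formal. It also gives the embedding: two cubes of `C` with the same image
differ by a deck transformation (`exists_deck`), which then preserves `A'` and `B'`, hence `C`.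

The geometry of `U` is that of words of labels in a `SquareSystem`. Two words are equivalent if
they differ by pushing walks across squares. The flag condition for triangles in the links shows
that moving a letter to the front of a word is compatible with equivalence (`Eqv.front`); from
this, words have normal forms, unique up to equivalence and invariant under homotopy (`NFEq`), so
in a simply connected system reduced words are geodesics and any two with the same ends are
equivalent.

For a locally convex subcomplex, a vertex `c` is closest to `b` if and only if no geodesic from
`c` to `b` starts with an edge of the subcomplex, that is, if `c` is a gate. Write a geodesic from
`b` in `B'` to its gate `c` in `A'` as a walk in `B'` followed by a word that leaves `B'` at a
gate, the bridge. When `b` moves along an edge of `B'`, either `c` stays, or the edge is pushed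
along the whole geodesic into `A'`; in both cases the bridge does not change (`Bridge.step`).
-/

/-! ### Square systems -/

/-- An edge-labelled graph with squares: `ok x a` says that the vertex `x` has an edge labelled
`a`, `mv x a` is the other end of that edge, and `sq x a b` says that the edges labelled `a` and
`b` at `x` span a square, whose opposite edges carry the same label. A vertex has at most one edge
with a given label. If `x` has no edge labelled `a`, then `mv x a` is a junk value. The field
`cube` is the flag condition for triangles in the links. -/
structure SquareSystem (V : Type v) (L : Type u) where
  ok : V → L → Prop
  mv : V → L → V
  sq : V → L → L → Prop
  ok_mv : ∀ {x a}, ok x a → ok (mv x a) a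
  mv_mv : ∀ {x a}, ok x a → mv (mv x a) a = x
  sq_ok : ∀ {x a b}, sq x a b → ok x a
  sq_ne : ∀ {x a b}, sq x a b → a ≠ b
  sq_symm : ∀ {x a b}, sq x a b → sq x b a
  sq_mv : ∀ {x a b}, sq x a b → sq (mv x a) a b
  mv_comm : ∀ {x a b}, sq x a b → mv (mv x a) b = mv (mv x b) a
  cube : ∀ {x a b c}, sq x a b → sq x a c → sq x b c → sq (mv x a) b c

namespace SquareSystem

variable {V : Type v} {L : Type u} (S : SquareSystem V L)

/-! ### Words of labels as walks -/

/-- The end of the walk that starts at `x` and reads the word `w`. -/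
def dest : V → List L → V
  | x, [] => x
  | x, a :: w => dest (S.mv x a) w

/-- There is a walk that starts at `x` and reads the word `w`. -/
def IsWalk : V → List L → Prop
  | _, [] => True
  | x, a :: w => S.ok x a ∧ IsWalk (S.mv x a) w

/-- Two words are related if they differ by pushing the walks that start at `x` across squares. -/
inductive Eqv : V → List L → List L → Prop
  | refl (x : V) (w : List L) : Eqv x w w
  | swap {x : V} {a b : L} (w : List L) : S.sq x a b → Eqv x (a :: b :: w) (b :: a :: w)
  | cons {x : V} {a : L} {w w' : List L} : Eqv (S.mv x a) w w' → Eqv x (a :: w) (a :: w')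
  | trans {x : V} {w w' w'' : List L} : Eqv x w w' → Eqv x w' w'' → Eqv x w w''

/-- The edge labelled `h` at `x` can be pushed along the walk `u` through a ladder of squares. -/
def Cross : V → L → List L → Prop
  | _, _, [] => True
  | x, h, a :: u => S.sq x a h ∧ Cross (S.mv x a) h u

/-- The letter `h` can be moved to the front of the word `w`, read from `x`. -/
def Front (x : V) (w : List L) (h : L) : Prop :=
  ∃ u v, w = u ++ h :: v ∧ S.Cross x h u

/-- No word equivalent to `w` contains a backtrack. -/
def Reduced (x : V) (w : List L) : Prop :=
  ∀ u a v, ¬ S.Eqv x w (u ++ a :: a :: v)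

variable {S}

theorem sq_ok' {x : V} {a b : L} (h : S.sq x a b) : S.ok x b := S.sq_ok (S.sq_symm h)

/-- The square, seen from the end of its second edge. -/
theorem sq_mv' {x : V} {a b : L} (h : S.sq x a b) : S.sq (S.mv x b) a b :=
  S.sq_symm (S.sq_mv (S.sq_symm h))

theorem dest_append (x : V) (u v : List L) :
    S.dest x (u ++ v) = S.dest (S.dest x u) v := by
  induction u generalizing x with
  | nil => rfl
  | cons a u ih => exact ih _

theorem isWalk_append {x : V} {u v : List L} :
    S.IsWalk x (u ++ v) ↔ S.IsWalk x u ∧ S.IsWalk (S.dest x u) v := by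
  induction u generalizing x with
  | nil => simp [IsWalk, dest]
  | cons a u ih => simp only [List.cons_append, IsWalk, dest, ih, and_assoc]

theorem IsWalk.reverse {x : V} {w : List L} (h : S.IsWalk x w) :
    S.IsWalk (S.dest x w) w.reverse ∧ S.dest (S.dest x w) w.reverse = x := by
  induction w generalizing x with
  | nil => exact ⟨trivial, rfl⟩
  | cons a w ih =>
    obtain ⟨h1, h2⟩ := ih h.2
    simp only [List.reverse_cons, isWalk_append, dest_append, dest]
    rw [h2]
    exact ⟨⟨h1, S.ok_mv h.1, trivial⟩, S.mv_mv h.1⟩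

/-! ### Equivalence of words -/

namespace Eqv

theorem symm {x : V} {w w' : List L} (h : S.Eqv x w w') : S.Eqv x w' w := by
  induction h with
  | refl x w => exact .refl x w
  | swap w h => exact .swap w (S.sq_symm h)
  | cons _ ih => exact .cons ih
  | trans _ _ ih ih' => exact ih'.trans ih

theorem dest_eq {x : V} {w w' : List L} (h : S.Eqv x w w') : S.dest x w = S.dest x w' := by
  induction h with
  | refl x w => rfl
  | swap w h => simp only [dest, S.mv_comm h]
  | cons _ ih => exact ih
  | trans _ _ ih ih' => exact ih.trans ih'

theorem length_eq {x : V} {w w' : List L} (h : S.Eqv x w w') : w.length = w'.length := by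
  induction h with
  | refl x w => rfl
  | swap w h => rfl
  | cons _ ih => simp [ih]
  | trans _ _ ih ih' => exact ih.trans ih'

theorem isWalk {x : V} {w w' : List L} (h : S.Eqv x w w') (hw : S.IsWalk x w) :
    S.IsWalk x w' := by
  induction h with
  | refl x w => exact hw
  | swap w h =>
    refine ⟨sq_ok' h, sq_ok' (S.sq_mv (S.sq_symm h)), ?_⟩
    rw [← S.mv_comm h]
    exact hw.2.2
  | cons _ ih => exact ⟨hw.1, ih hw.2⟩
  | trans _ _ ih ih' => exact ih' (ih hw)

theorem append_left {x : V} (u : List L) {w w' : List L} (h : S.Eqv (S.dest x u) w w') :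
    S.Eqv x (u ++ w) (u ++ w') := by
  induction u generalizing x with
  | nil => exact h
  | cons a u ih => exact .cons (ih h)

theorem append_right {x : V} {w w' : List L} (h : S.Eqv x w w') (v : List L) :
    S.Eqv x (w ++ v) (w' ++ v) := by
  induction h with
  | refl x w => exact .refl x _
  | swap w h => exact .swap (w ++ v) h
  | cons _ ih => exact .cons ih
  | trans _ _ ih ih' => exact ih.trans ih'

theorem reverse {x : V} {w w' : List L} (h : S.Eqv x w w') (hw : S.IsWalk x w) :
    S.Eqv (S.dest x w) w.reverse w'.reverse := by
  induction h with
  | refl x w => exact .refl _ _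
  | @swap x a b w h =>
    simp only [List.reverse_cons, List.append_assoc, List.singleton_append]
    apply append_left
    simp only [dest, hw.2.2.reverse.2]
    exact .swap [] (S.sq_mv (S.sq_symm (S.sq_mv h)))
  | cons _ ih =>
    simp only [List.reverse_cons]
    exact (ih hw.2).append_right _
  | trans h _ ih ih' =>
    refine (ih hw).trans ?_
    rw [h.dest_eq]
    exact ih' (h.isWalk hw)

end Eqv

/-! ### Ladders of squares -/

namespace Cross

theorem append {x : V} {h : L} {u v : List L} :
    S.Cross x h (u ++ v) ↔ S.Cross x h u ∧ S.Cross (S.dest x u) h v := by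
  induction u generalizing x with
  | nil => simp [Cross, dest]
  | cons a u ih => simp only [List.cons_append, Cross, dest, ih, and_assoc]

theorem eqv {x : V} {h : L} {u : List L} (hc : S.Cross x h u) (v : List L) :
    S.Eqv x (u ++ h :: v) (h :: (u ++ v)) := by
  induction u generalizing x with
  | nil => exact .refl _ _
  | cons a u ih => exact (Eqv.cons (ih hc.2)).trans (.swap _ hc.1)

theorem dest_mv {x : V} {h : L} {u : List L} (hc : S.Cross x h u) :
    S.dest (S.mv x h) u = S.mv (S.dest x u) h := by
  have := (hc.eqv []).dest_eq
  simpa [dest, dest_append] using this.symm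

/-- The other side of the ladder. -/
theorem mv {x : V} {h : L} {u : List L} (hc : S.Cross x h u) : S.Cross (S.mv x h) h u := by
  induction u generalizing x with
  | nil => trivial
  | cons a u ih =>
    refine ⟨sq_mv' hc.1, ?_⟩
    rw [← S.mv_comm hc.1]
    exact ih hc.2

theorem isWalk {x : V} {h : L} {u : List L} (hc : S.Cross x h u) : S.IsWalk x u := by
  induction u generalizing x with
  | nil => trivial
  | cons a u ih => exact ⟨S.sq_ok hc.1, ih hc.2⟩

theorem reverse {x : V} {h : L} {u : List L} (hc : S.Cross x h u) :
    S.Cross (S.dest x u) h u.reverse := by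
  induction u generalizing x with
  | nil => trivial
  | cons a u ih =>
    simp only [List.reverse_cons, append, dest, hc.2.isWalk.reverse.2]
    exact ⟨ih hc.2, S.sq_mv hc.1, trivial⟩

/-- If `h` crosses `s`, and `k` crosses the opposite side of that ladder, and both span a square at
the end of `s`, then the product of `s` with this square is a union of cubes. -/
theorem of_mv {x : V} {h k : L} {s : List L} (hc : S.Cross x h s) (hk : S.Cross (S.mv x h) k s)
    (hs : S.sq (S.dest x s) h k) : S.Cross x k s ∧ S.sq x h k := by
  induction s generalizing x with
  | nil => exact ⟨trivial, hs⟩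
  | cons a s ih =>
    have hk2 := hk.2
    rw [← S.mv_comm hc.1] at hk2
    obtain ⟨h1, h2⟩ := ih hc.2 hk2 hs
    -- the cube at the corner of the square on `a` and `h` that is opposite to `x`
    have e1 : S.sq (S.mv (S.mv x a) h) a k := by
      rw [S.mv_comm hc.1]
      exact S.sq_mv hk.1
    have e2 : S.sq (S.mv (S.mv x a) h) h k := S.sq_mv h2
    have e3 : S.sq (S.mv (S.mv x a) h) a h := sq_mv' (S.sq_mv hc.1)
    have ha : S.ok x a := S.sq_ok hc.1
    have hh : S.ok (S.mv x a) h := sq_ok' (S.sq_mv hc.1)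
    have f1 : S.sq (S.mv x a) a k := by
      simpa only [S.mv_mv hh] using S.cube (S.sq_symm e3) e2 e1
    have f2 := S.cube (S.sq_mv hc.1) f1 h2
    have f3 := S.sq_mv f1
    rw [S.mv_mv ha] at f2 f3
    exact ⟨⟨f3, h1⟩, f2⟩

end Cross

/-! ### Letters that can be moved to the front -/

/-- Moving a letter to the front is compatible with the equivalence of words; this is where
the flag condition enters. -/
theorem Eqv.front {x : V} {w w' : List L} (he : S.Eqv x w w') {u v : List L} {h : L}
    (hw : w = u ++ h :: v) (hc : S.Cross x h u) :
    ∃ u' v', w' = u' ++ h :: v' ∧ S.Cross x h u' ∧ S.Eqv (S.mv x h) (u ++ v) (u' ++ v') := by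
  induction he generalizing u v h with
  | refl x w => exact ⟨u, v, hw, hc, .refl _ _⟩
  | @swap x a b w hs =>
    rcases u with _ | ⟨c, _ | ⟨d, u⟩⟩
    · simp only [List.nil_append, List.cons.injEq] at hw
      obtain ⟨rfl, rfl⟩ := hw
      exact ⟨[b], w, rfl, ⟨S.sq_symm hs, trivial⟩, .refl _ _⟩
    · simp only [List.cons_append, List.nil_append, List.cons.injEq] at hw
      obtain ⟨rfl, rfl, rfl⟩ := hw
      exact ⟨[], a :: w, rfl, trivial, .refl _ _⟩
    · simp only [List.cons_append, List.cons.injEq] at hw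
      obtain ⟨rfl, rfl, rfl⟩ := hw
      obtain ⟨h1, h2, h3⟩ := hc
      have k : S.sq x b h := by
        simpa only [S.mv_mv (S.sq_ok hs)] using S.cube (S.sq_mv hs) (S.sq_mv h1) h2
      refine ⟨b :: a :: u, v, rfl, ⟨k, S.cube (S.sq_symm hs) k h1, ?_⟩, ?_⟩
      · rw [← S.mv_comm hs]
        exact h3
      · exact .swap _ (S.cube (S.sq_symm h1) (S.sq_symm k) hs)
  | @cons x a w w' he ih =>
    rcases u with _ | ⟨c, u⟩
    · simp only [List.nil_append, List.cons.injEq] at hw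
      obtain ⟨rfl, rfl⟩ := hw
      exact ⟨[], w', rfl, trivial, he⟩
    · simp only [List.cons_append, List.cons.injEq] at hw
      obtain ⟨rfl, rfl⟩ := hw
      obtain ⟨u', v', rfl, h2, h3⟩ := ih rfl hc.2
      refine ⟨a :: u', v', rfl, ⟨hc.1, h2⟩, .cons ?_⟩
      rw [← S.mv_comm hc.1]
      exact h3
  | trans _ _ ih ih' =>
    obtain ⟨u', v', h1, h2, h3⟩ := ih hw hc
    obtain ⟨u'', v'', h4, h5, h6⟩ := ih' h1 h2
    exact ⟨u'', v'', h4, h5, h3.trans h6⟩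

theorem front_iff {x : V} {w : List L} {h : L} : S.Front x w h ↔ ∃ r, S.Eqv x w (h :: r) := by
  constructor
  · rintro ⟨u, v, rfl, hc⟩
    exact ⟨_, hc.eqv v⟩
  · rintro ⟨r, he⟩
    obtain ⟨u, v, h1, h2, -⟩ := he.symm.front (u := []) rfl trivial
    exact ⟨u, v, h1, h2⟩

theorem Front.eqv {x : V} {w w' : List L} {h : L} (hf : S.Front x w h) (he : S.Eqv x w w') :
    S.Front x w' h := by
  obtain ⟨u, v, h1, h2⟩ := hf
  obtain ⟨u', v', h3, h4, -⟩ := he.front h1 h2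
  exact ⟨u', v', h3, h4⟩

theorem Eqv.of_cons {x : V} {a : L} {w w' : List L} (he : S.Eqv x (a :: w) (a :: w')) :
    S.Eqv (S.mv x a) w w' := by
  obtain ⟨u, v, h1, h2, h3⟩ := he.front (u := []) rfl trivial
  rcases u with _ | ⟨b, u⟩
  · simp only [List.nil_append, List.cons.injEq] at h1
    obtain ⟨-, rfl⟩ := h1
    exact h3
  · simp only [List.cons_append, List.cons.injEq] at h1
    obtain ⟨rfl, -⟩ := h1
    exact absurd rfl (S.sq_ne h2.1)

/-- Two different letters that can be moved to the front span a square. -/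
theorem Eqv.diamond {x : V} {a b : L} {w w' : List L} (he : S.Eqv x (a :: w) (b :: w'))
    (hab : a ≠ b) : S.sq x a b ∧
      ∃ u, S.Eqv (S.mv x a) w (b :: u) ∧ S.Eqv (S.mv x b) w' (a :: u) := by
  obtain ⟨u, v, h1, h2, h3⟩ := he.symm.front (u := []) rfl trivial
  rcases u with _ | ⟨c, u⟩
  · simp only [List.nil_append, List.cons.injEq] at h1
    exact absurd h1.1 hab
  · simp only [List.cons_append, List.cons.injEq] at h1
    obtain ⟨rfl, rfl⟩ := h1
    exact ⟨h2.1, u ++ v, h2.2.eqv v, h3⟩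

/-- If `h` crosses the whole word `w`, a letter that can be moved to the front of `w` on one side
of the ladder can be moved to the front on the other side. -/
theorem Front.of_mv {x : V} {h k : L} {w : List L} (hf : S.Front (S.mv x h) w k)
    (hc : S.Cross x h w) : S.Front x w k ∧ S.sq x h k := by
  obtain ⟨s, t, rfl, hk⟩ := hf
  rw [Cross.append] at hc
  obtain ⟨h1, h2⟩ := Cross.of_mv hc.1 hk (S.sq_symm hc.2.1)
  exact ⟨⟨s, t, rfl, h1⟩, h2⟩

/-! ### Reduced words -/

namespace Reduced

theorem eqv {x : V} {w w' : List L} (hr : S.Reduced x w) (he : S.Eqv x w w') :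
    S.Reduced x w' := fun u a v h => hr u a v (he.trans h)

theorem right {x : V} {u w : List L} (hr : S.Reduced x (u ++ w)) : S.Reduced (S.dest x u) w :=
  fun u' a v h => hr (u ++ u') a v (by
    rw [List.append_assoc]
    exact h.append_left)

theorem left {x : V} {w v : List L} (hr : S.Reduced x (w ++ v)) : S.Reduced x w :=
  fun u' a v' h => hr u' a (v' ++ v) (by simpa using h.append_right v)

theorem tail {x : V} {a : L} {w : List L} (hr : S.Reduced x (a :: w)) :
    S.Reduced (S.mv x a) w := right (u := [a]) hr

theorem not_front {x : V} {a : L} {w : List L} (hr : S.Reduced x (a :: w)) :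
    ¬ S.Front (S.mv x a) w a := by
  rw [front_iff]
  rintro ⟨r, h⟩
  exact hr [] a r (.cons h)

theorem nil (x : V) : S.Reduced x [] := fun u a v h => by
  simpa using h.length_eq

theorem cons {x : V} {a : L} {w : List L} (hr : S.Reduced (S.mv x a) w)
    (hf : ¬ S.Front (S.mv x a) w a) : S.Reduced x (a :: w) := by
  induction hn : w.length generalizing x w with
  | zero =>
    intro u b v h
    have := h.length_eq
    simp [hn] at this
    omega
  | succ n ih =>
    intro u b v h
    rcases u with _ | ⟨c, u⟩
    · by_cases hab : a = b
      · subst hab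
        exact hf (front_iff.2 ⟨v, h.of_cons⟩)
      · obtain ⟨hs, t, h1, h2⟩ := h.diamond hab
        obtain ⟨-, t', -, h4⟩ := h2.diamond (Ne.symm hab)
        rw [← S.mv_comm hs] at h4
        exact hr [] b t' (h1.trans (.cons h4))
    · by_cases hac : a = c
      · subst hac
        exact hr _ _ _ h.of_cons
      · obtain ⟨hs, t, h1, h2⟩ := h.diamond hac
        have hrt := (hr.eqv h1).tail
        rw [S.mv_comm hs] at hrt
        refine ih hrt ?_ (by simpa [hn] using h1.length_eq.symm) u b v h2.symm
        rw [← S.mv_comm hs, front_iff]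
        rintro ⟨r, h3⟩
        exact hf (front_iff.2 ⟨_, h1.trans ((Eqv.cons h3).trans
          (.swap r (S.sq_symm (S.sq_mv hs))))⟩)

theorem reverse {x : V} {w : List L} (hr : S.Reduced x w) (hw : S.IsWalk x w) :
    S.Reduced (S.dest x w) w.reverse := by
  intro u a v h
  have h' := h.reverse hw.reverse.1
  rw [hw.reverse.2, List.reverse_reverse] at h'
  exact hr v.reverse a u.reverse (by simpa using h')

end Reduced

/-! ### Normal forms -/

variable (S) in
/-- `r` is obtained from the walk `w` by deleting backtracks; it is unique up to equivalence. -/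
inductive NF : V → List L → List L → Prop
  | nil (x : V) : NF x [] []
  | cons {x : V} {a : L} {w s r : List L} : S.ok x a → NF (S.mv x a) w s →
      ¬ S.Front (S.mv x a) s a → S.Eqv x (a :: s) r → NF x (a :: w) r
  | cancel {x : V} {a : L} {w s r : List L} : S.ok x a → NF (S.mv x a) w s →
      S.Eqv (S.mv x a) s (a :: r) → NF x (a :: w) r

namespace NF

theorem reduced {x : V} {w r : List L} (h : S.NF x w r) : S.Reduced x r := by
  induction h with
  | nil x => exact Reduced.nil x
  | cons _ _ hf he ih => exact (ih.cons hf).eqv he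
  | cancel ho _ he ih =>
    have := (ih.eqv he).tail
    rwa [S.mv_mv ho] at this

theorem eqv {x : V} {w r r' : List L} (h : S.NF x w r) (he : S.Eqv x r r') : S.NF x w r' := by
  cases h with
  | nil =>
    have : r' = [] := List.length_eq_zero_iff.1 he.length_eq.symm
    subst this
    exact .nil _
  | cons ho h hf he' => exact .cons ho h hf (he'.trans he)
  | @cancel _ a _ _ _ ho h he' =>
    refine .cancel ho h (he'.trans (.cons ?_))
    rwa [S.mv_mv ho]

theorem exists_of_isWalk {x : V} {w : List L} (h : S.IsWalk x w) : ∃ r, S.NF x w r := by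
  induction w generalizing x with
  | nil => exact ⟨_, .nil x⟩
  | cons a w ih =>
    obtain ⟨s, hs⟩ := ih h.2
    by_cases hf : S.Front (S.mv x a) s a
    · obtain ⟨r, hr⟩ := front_iff.1 hf
      exact ⟨r, .cancel h.1 hs hr⟩
    · exact ⟨_, .cons h.1 hs hf (.refl _ _)⟩

theorem unique {x : V} {w r r' : List L} (h : S.NF x w r) (h' : S.NF x w r') :
    S.Eqv x r r' := by
  induction h generalizing r' with
  | nil x =>
    cases h'
    exact .refl _ _
  | cons ho h hf he ih =>
    cases h' with
    | cons ho' h' hf' he' => exact he.symm.trans ((Eqv.cons (ih h')).trans he')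
    | cancel ho' h' he' => exact absurd (front_iff.2 ⟨_, (ih h').trans he'⟩) hf
  | cancel ho h he ih =>
    cases h' with
    | cons ho' h' hf' he' => exact absurd (front_iff.2 ⟨_, (ih h').symm.trans he⟩) hf'
    | cancel ho' h' he' =>
      have := (he.symm.trans ((ih h').trans he')).of_cons
      rwa [S.mv_mv ho] at this

theorem isWalk {x : V} {w r : List L} (h : S.NF x w r) : S.IsWalk x w := by
  induction h with
  | nil x => trivial
  | cons ho _ _ _ ih => exact ⟨ho, ih⟩
  | cancel ho _ _ ih => exact ⟨ho, ih⟩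

theorem isWalk_right {x : V} {w r : List L} (h : S.NF x w r) : S.IsWalk x r := by
  induction h with
  | nil x => trivial
  | cons ho _ _ he ih => exact he.isWalk ⟨ho, ih⟩
  | cancel ho _ he ih =>
    have := (he.isWalk ih).2
    rwa [S.mv_mv ho] at this

theorem dest_eq {x : V} {w r : List L} (h : S.NF x w r) : S.dest x w = S.dest x r := by
  induction h with
  | nil x => rfl
  | cons ho _ _ he ih => exact Eq.trans ih he.dest_eq
  | cancel ho _ he ih =>
    have := he.dest_eq
    simp only [dest, S.mv_mv ho] at this
    exact ih.trans this

theorem length_le {x : V} {w r : List L} (h : S.NF x w r) : r.length ≤ w.length := by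
  induction h with
  | nil x => exact le_rfl
  | cons ho _ _ he ih =>
    rw [← he.length_eq]
    exact Nat.succ_le_succ ih
  | cancel ho _ he ih =>
    have := he.length_eq
    simp only [List.length_cons] at this ⊢
    omega

theorem self {x : V} {w : List L} (hw : S.IsWalk x w) (hr : S.Reduced x w) : S.NF x w w := by
  induction w generalizing x with
  | nil => exact .nil x
  | cons a w ih => exact .cons hw.1 (ih hw.2 hr.tail) hr.not_front (.refl _ _)

end NF

variable (S) in
/-- Two words read from `x` have the same normal forms. -/
def NFEq (x : V) (w w' : List L) : Prop := ∀ r, S.NF x w r ↔ S.NF x w' r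

namespace NFEq

theorem of_common {x : V} {w w' r : List L} (h : S.NF x w r) (h' : S.NF x w' r) :
    S.NFEq x w w' :=
  fun _ => ⟨fun k => h'.eqv (h.unique k), fun k => h.eqv (h'.unique k)⟩

theorem symm {x : V} {w w' : List L} (h : S.NFEq x w w') : S.NFEq x w' w := fun r => (h r).symm

theorem trans {x : V} {w w' w'' : List L} (h : S.NFEq x w w') (h' : S.NFEq x w' w'') :
    S.NFEq x w w'' := fun r => (h r).trans (h' r)

theorem refl (x : V) (w : List L) : S.NFEq x w w := fun _ => Iff.rfl

theorem cons {x : V} {a : L} {w w' : List L} (h : S.NFEq (S.mv x a) w w') :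
    S.NFEq x (a :: w) (a :: w') := by
  have key : ∀ {w w' : List L}, S.NFEq (S.mv x a) w w' → ∀ r, S.NF x (a :: w) r →
      S.NF x (a :: w') r := by
    intro w w' h r hr
    cases hr with
    | cons ho k hf he => exact .cons ho ((h _).1 k) hf he
    | cancel ho k he => exact .cancel ho ((h _).1 k) he
  exact fun r => ⟨key h r, key h.symm r⟩

theorem append_left {x : V} (u : List L) {w w' : List L} (h : S.NFEq (S.dest x u) w w') :
    S.NFEq x (u ++ w) (u ++ w') := by
  induction u generalizing x with
  | nil => exact h
  | cons a u ih => exact .cons (ih h)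

theorem backtrack {x : V} {a : L} (ho : S.ok x a) {w : List L} (hw : S.IsWalk x w) :
    S.NFEq x (a :: a :: w) w := by
  obtain ⟨r, hr⟩ := NF.exists_of_isWalk hw
  refine of_common (r := r) ?_ hr
  have hr' : S.NF (S.mv (S.mv x a) a) w r := by rwa [S.mv_mv ho]
  have hmv := S.mv_mv ho
  by_cases hf : S.Front x r a
  · obtain ⟨t, ht⟩ := front_iff.1 hf
    exact .cons ho (.cancel (s := r) (S.ok_mv ho) hr' (by rwa [hmv])) (hr.reduced.eqv ht).not_front
      ht.symm
  · exact .cancel ho (.cons (S.ok_mv ho) hr' (by rwa [hmv]) (.refl _ _)) (.refl _ _)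

theorem swap {x : V} {a b : L} (hs : S.sq x a b) {w : List L}
    (hw : S.IsWalk (S.mv (S.mv x a) b) w) : S.NFEq x (a :: b :: w) (b :: a :: w) := by
  have hab : a ≠ b := S.sq_ne hs
  -- the case in which exactly one of the two letters cancels
  have one : ∀ {a b : L}, S.sq x a b → ∀ {q r : List L}, S.NF (S.mv (S.mv x a) b) w q →
      S.Eqv (S.mv (S.mv x a) b) q (b :: r) → ¬ S.Front (S.mv (S.mv x a) b) q a →
      S.NFEq x (a :: b :: w) (b :: a :: w) := by
    intro a b hs q r hq hr hf
    have hqb := hq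
    have hfb := hf
    have hrb := hr
    rw [S.mv_comm hs] at hqb hfb hrb
    have hoa := S.sq_ok hs
    have hob := sq_ok' hs
    have hob' := sq_ok' (S.sq_mv hs)
    have hoa' := S.sq_ok (sq_mv' hs)
    refine of_common (r := a :: r) ?_ ?_
    · refine .cons hoa (.cancel hob' hq hr) (fun h => hf ?_) (.refl _ _)
      obtain ⟨t, ht⟩ := front_iff.1 h
      refine front_iff.2 ⟨_, hr.trans (Eqv.trans (.cons ?_)
        (.swap t (S.sq_mv (S.sq_symm (S.sq_mv hs)))))⟩
      rwa [S.mv_mv hob']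
    · refine .cancel hob (.cons hoa' hqb hfb (.refl _ _)) ?_
      exact (Eqv.cons hrb).trans (.swap _ (sq_mv' hs))
  obtain ⟨q, hq⟩ := NF.exists_of_isWalk hw
  have hqb := hq
  rw [S.mv_comm hs] at hqb
  have hoa := S.sq_ok hs
  have hob := sq_ok' hs
  have hob' := sq_ok' (S.sq_mv hs)
  have hoa' := S.sq_ok (sq_mv' hs)
  by_cases hfa : S.Front (S.mv (S.mv x a) b) q a
  · obtain ⟨s, hqs⟩ := front_iff.1 hfa
    by_cases hfb : S.Front (S.mv (S.mv x a) b) q b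
    · obtain ⟨r, hqr⟩ := front_iff.1 hfb
      obtain ⟨-, t, h1, h2⟩ := (hqs.symm.trans hqr).diamond hab
      rw [S.mv_mv hob'] at h2
      rw [S.mv_comm hs] at h1 hqs
      rw [S.mv_mv hoa'] at h1
      exact of_common (r := t) (.cancel hoa (.cancel hob' hq hqr) h2)
        (.cancel hob (.cancel hoa' hqb hqs) h1)
    · rw [S.mv_comm hs] at hfb hqs
      exact (one (S.sq_symm hs) hqb hqs hfb).symm
  · by_cases hfb : S.Front (S.mv (S.mv x a) b) q b
    · obtain ⟨r, hqr⟩ := front_iff.1 hfb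
      exact one hs hq hqr hfa
    · have hfa' := hfa
      have hfb' := hfb
      rw [S.mv_comm hs] at hfa' hfb'
      have key : ∀ {y : V} {a b : L}, a ≠ b → ¬ S.Front (S.mv y b) q a →
          ¬ S.Front y (b :: q) a := by
        intro y a b hab h hf
        obtain ⟨t, ht⟩ := front_iff.1 hf
        obtain ⟨-, t', h1, -⟩ := ht.diamond (Ne.symm hab)
        exact h (front_iff.2 ⟨t', h1⟩)
      exact of_common (r := a :: b :: q)
        (.cons hoa (.cons hob' hq hfb (.refl _ _)) (key hab hfa) (.refl _ _))
        (.cons hob (.cons hoa' hqb hfa' (.refl _ _)) (key (Ne.symm hab) hfb')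
          (.swap q (S.sq_symm hs)))

theorem of_eqv {x : V} {w w' : List L} (h : S.Eqv x w w') (hw : S.IsWalk x w) :
    S.NFEq x w w' := by
  induction h with
  | refl x w => exact refl x w
  | swap w h => exact swap h hw.2.2
  | cons _ ih => exact cons (ih hw.2)
  | trans h _ ih ih' => exact (ih hw).trans (ih' (h.isWalk hw))

/-- A walk may be replaced by its normal form in front of any walk. -/
theorem of_nf {x : V} {w r : List L} (h : S.NF x w r) {t : List L}
    (ht : S.IsWalk (S.dest x w) t) : S.NFEq x (w ++ t) (r ++ t) := by
  induction h with
  | nil x => exact refl _ _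
  | cons ho h hf he ih =>
    refine (cons (ih ht)).trans (of_eqv (he.append_right t) ⟨ho, ?_⟩)
    exact isWalk_append.2 ⟨h.isWalk_right, by rwa [← h.dest_eq]⟩
  | cancel ho h he ih =>
    have hst := isWalk_append.2 ⟨h.isWalk_right, h.dest_eq ▸ ht⟩
    have he' := he.append_right t
    refine (cons ((ih ht).trans (of_eqv he' hst))).trans (backtrack ho ?_)
    have := (he'.isWalk hst).2
    rwa [S.mv_mv ho] at this

end NFEq

/-! ### Simply connected systems -/

variable (S) in
/-- Every closed walk can be contracted by deleting backtracks and pushing across squares. -/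
def LoopsContract : Prop := ∀ x w, S.IsWalk x w → S.dest x w = x → S.NF x w []

/-- Reduced words with the same ends are equivalent. -/
theorem LoopsContract.eqv (hl : S.LoopsContract) {x : V} {w w' : List L} (hw : S.IsWalk x w)
    (hw' : S.IsWalk x w') (hd : S.dest x w = S.dest x w') (hr : S.Reduced x w)
    (hr' : S.Reduced x w') : S.Eqv x w w' := by
  obtain ⟨k1, k2⟩ := hw'.reverse
  have e1 : S.NF x (w ++ w'.reverse) [] := by
    apply hl
    · rw [isWalk_append, hd]
      exact ⟨hw, k1⟩
    · rw [dest_append, hd, k2]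
  have e2 : S.NF (S.dest x w) (w'.reverse ++ w') [] := by
    apply hl
    · rw [isWalk_append, hd, k2]
      exact ⟨k1, hw'⟩
    · rw [dest_append, hd, k2]
  have f1 := NFEq.of_nf e1 (t := w') (by rwa [e1.dest_eq])
  have f2 := (NFEq.of_nf e2 (t := []) trivial).append_left w
  simp only [List.append_nil, List.nil_append, List.append_assoc] at f1 f2
  exact (NF.self hw hr).unique (((f2.symm.trans f1) w').2 (NF.self hw' hr'))

/-- A symmetric relation between vertices that have the same labels and squares. -/
structure Bisimulation (S : SquareSystem V L) (R : V → V → Prop) : Prop where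
  symm : ∀ {x y}, R x y → R y x
  ok : ∀ {x y a}, R x y → S.ok x a → S.ok y a
  sq : ∀ {x y a b}, R x y → S.sq x a b → S.sq y a b
  mv : ∀ {x y} (a), R x y → R (S.mv x a) (S.mv y a)

namespace Bisimulation

variable {R : V → V → Prop}

theorem isWalk (hR : S.Bisimulation R) {x y : V} (h : R x y) {w : List L} (hw : S.IsWalk x w) :
    S.IsWalk y w := by
  induction w generalizing x y with
  | nil => trivial
  | cons a w ih => exact ⟨hR.ok h hw.1, ih (hR.mv a h) hw.2⟩

theorem dest (hR : S.Bisimulation R) {x y : V} (h : R x y) (w : List L) :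
    R (S.dest x w) (S.dest y w) := by
  induction w generalizing x y with
  | nil => exact h
  | cons a w ih => exact ih (hR.mv a h)

theorem eqv (hR : S.Bisimulation R) {x y : V} (h : R x y) {w w' : List L} (he : S.Eqv x w w') :
    S.Eqv y w w' := by
  induction he generalizing y with
  | refl x w => exact .refl _ _
  | swap w hs => exact .swap w (hR.sq h hs)
  | cons _ ih => exact .cons (ih (hR.mv _ h))
  | trans _ _ ih ih' => exact (ih h).trans (ih' h)

theorem nf (hR : S.Bisimulation R) {x y : V} (h : R x y) {w r : List L} (hn : S.NF x w r) :
    S.NF y w r := by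
  induction hn generalizing y with
  | nil x => exact .nil y
  | cons ho hn hf he ih =>
    refine .cons (hR.ok h ho) (ih (hR.mv _ h)) (fun k => hf ?_) (hR.eqv h he)
    obtain ⟨t, ht⟩ := front_iff.1 k
    exact front_iff.2 ⟨t, hR.eqv (hR.symm (hR.mv _ h)) ht⟩
  | cancel ho hn he ih => exact .cancel (hR.ok h ho) (ih (hR.mv _ h)) (hR.eqv (hR.mv _ h) he)

/-- Words that lead from `x` to the same vertex lead from `y` to the same vertex. -/
theorem dest_eq (hR : S.Bisimulation R) (hl : S.LoopsContract) {x y : V} (h : R x y) {w w' : List L}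
    (hw : S.IsWalk x w) (hw' : S.IsWalk x w') (hd : S.dest x w = S.dest x w') :
    S.dest y w = S.dest y w' := by
  have e1 : S.NF x (w ++ w'.reverse) [] := by
    apply hl
    · rw [isWalk_append, hd]
      exact ⟨hw, hw'.reverse.1⟩
    · rw [dest_append, hd, hw'.reverse.2]
  have e2 := hR.nf h e1
  have e3 := e2.dest_eq
  rw [dest_append] at e3
  have e4 := (isWalk_append.1 e2.isWalk).2.reverse.2
  rw [e3, List.reverse_reverse] at e4
  exact e4.symm

end Bisimulation

end SquareSystem

namespace SquareSystem

variable {V : Type v} {L : Type u} {S : SquareSystem V L}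

/-! ### Gates of locally convex sets of edges -/

/-- `T x a` says that the edge labelled `a` at `x` belongs to a fixed locally convex
subcomplex. -/
structure LocallyConvex (S : SquareSystem V L) (T : V → L → Prop) : Prop where
  ok : ∀ {x a}, T x a → S.ok x a
  mv : ∀ {x a}, T x a → T (S.mv x a) a
  sq : ∀ {x a b}, S.sq x a b → T x a → T x b → T (S.mv x a) b

variable (S) in
/-- The walk that starts at `x` and reads `w` runs through edges of `T`. -/
def WalkIn (T : V → L → Prop) : V → List L → Prop
  | _, [] => True
  | x, a :: w => T x a ∧ WalkIn T (S.mv x a) w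

variable (S) in
/-- No geodesic equivalent to `w` starts with an edge of `T`. If `x` is a vertex of a locally convex
subcomplex, this characterizes `x` as the closest vertex to the end of `w`. -/
def Gate (T : V → L → Prop) (x : V) (w : List L) : Prop := ∀ h, T x h → ¬ S.Front x w h

variable {T : V → L → Prop}

theorem Front.append {x : V} {w : List L} {h : L} (hf : S.Front x w h) (v : List L) :
    S.Front x (w ++ v) h := by
  obtain ⟨s, t, rfl, hc⟩ := hf
  exact ⟨s, t ++ v, by simp, hc⟩

theorem WalkIn.append {x : V} {u v : List L} :
    S.WalkIn T x (u ++ v) ↔ S.WalkIn T x u ∧ S.WalkIn T (S.dest x u) v := by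
  induction u generalizing x with
  | nil => simp [WalkIn, dest]
  | cons a u ih => simp only [List.cons_append, WalkIn, dest, ih, and_assoc]

namespace LocallyConvex

theorem isWalk (hT : S.LocallyConvex T) {x : V} {w : List L} (h : S.WalkIn T x w) :
    S.IsWalk x w := by
  induction w generalizing x with
  | nil => trivial
  | cons a w ih => exact ⟨hT.ok h.1, ih h.2⟩

theorem cross (hT : S.LocallyConvex T) {x : V} {h : L} {u : List L} (hc : S.Cross x h u)
    (hh : T x h) (hu : S.WalkIn T x u) : T (S.dest x u) h ∧ S.WalkIn T (S.mv x h) u := by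
  induction u generalizing x with
  | nil => exact ⟨hh, trivial⟩
  | cons a u ih =>
    obtain ⟨h1, h2⟩ := ih hc.2 (hT.sq hc.1 hu.1 hh) hu.2
    refine ⟨h1, hT.sq (S.sq_symm hc.1) hh hu.1, ?_⟩
    rwa [← S.mv_comm hc.1]

/-- A gate is carried over to the other side of a ladder whose end is an edge of `T`. -/
theorem gate_mv (hT : S.LocallyConvex T) {x : V} {h : L} {w : List L} (hg : S.Gate T x w)
    (hc : S.Cross x h w) (hh : T x h) : S.Gate T (S.mv x h) w := by
  intro k hk hf
  obtain ⟨h1, h2⟩ := hf.of_mv hc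
  have := hT.sq (S.sq_mv h2) (hT.mv hh) hk
  rw [S.mv_mv (hT.ok hh)] at this
  exact hg k this h1

/-- Let `v ++ w` be a reduced word that runs through `T` along `v` and leaves `T` at a gate.
Along an edge of `T` at the start, the word changes only in its part `v`. -/
theorem step (hT : S.LocallyConvex T) {x : V} {v w : List L} {a : L} (hv : S.WalkIn T x v)
    (hg : S.Gate T (S.dest x v) w) (hr : S.Reduced x (v ++ w)) (ha : T x a) :
    ∃ v', S.WalkIn T (S.mv x a) v' ∧ S.dest (S.mv x a) v' = S.dest x v ∧
      S.Reduced (S.mv x a) (v' ++ w) ∧ (v' = a :: v ∨ S.Eqv x (v ++ w) (a :: (v' ++ w))) := by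
  by_cases hf : S.Front x (v ++ w) a
  · obtain ⟨u, t, h1, h2⟩ := hf
    have main : ∀ s, v = u ++ a :: s → t = s ++ w → ∃ v', S.WalkIn T (S.mv x a) v' ∧
        S.dest (S.mv x a) v' = S.dest x v ∧ S.Reduced (S.mv x a) (v' ++ w) ∧
        (v' = a :: v ∨ S.Eqv x (v ++ w) (a :: (v' ++ w))) := by
      rintro s rfl rfl
      have he := h2.eqv (s ++ w)
      rw [← List.append_assoc, ← h1] at he
      have hv' := WalkIn.append.1 hv
      refine ⟨u ++ s, WalkIn.append.2 ⟨(hT.cross h2 ha hv'.1).2, ?_⟩, ?_, (hr.eqv he).tail, .inr he⟩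
      · rw [h2.dest_mv]
        exact hv'.2.2
      · simpa [dest] using (h2.eqv s).dest_eq.symm
    have other : ∀ s, u = v ++ s → w = s ++ a :: t → False := by
      rintro s rfl rfl
      rw [Cross.append] at h2
      exact hg a (hT.cross h2.1 ha hv).1 ⟨s, t, rfl, h2.2⟩
    rcases List.append_eq_append_iff.1 h1 with ⟨s, h3, h4⟩ | ⟨s, h3, h4⟩
    · exact (other s h3 h4).elim
    · rcases s with _ | ⟨b, s⟩
      · exact (other [] (by simpa using h3.symm) (by simpa using h4.symm)).elim
      · simp only [List.cons_append, List.cons.injEq] at h4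
        obtain ⟨rfl, h4⟩ := h4
        exact main s h3 h4
  · have hm := S.mv_mv (hT.ok ha)
    refine ⟨a :: v, ⟨hT.mv ha, by rwa [hm]⟩, by simp only [dest, hm], ?_, .inl rfl⟩
    exact Reduced.cons (w := v ++ w) (by rwa [hm]) (by rwa [hm])

/-- A gate of `T` lies on a geodesic to every vertex that can be reached through `T`. -/
theorem exists_reduced (hT : S.LocallyConvex T) {c : V} {w p : List L} (hg : S.Gate T c w)
    (hr : S.Reduced c w) (hp : S.WalkIn T c p) :
    ∃ v, S.WalkIn T (S.dest c p) v ∧ S.dest (S.dest c p) v = c ∧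
      S.Reduced (S.dest c p) (v ++ w) := by
  have key : ∀ (p : List L) (x : V) (v : List L), S.WalkIn T x v → S.dest x v = c →
      S.Reduced x (v ++ w) → S.WalkIn T x p → ∃ v, S.WalkIn T (S.dest x p) v ∧
        S.dest (S.dest x p) v = c ∧ S.Reduced (S.dest x p) (v ++ w) := by
    intro p
    induction p with
    | nil => exact fun x v h1 h2 h3 _ => ⟨v, h1, h2, h3⟩
    | cons a p ih =>
      intro x v h1 h2 h3 h4
      obtain ⟨v', k1, k2, k3, -⟩ := hT.step h1 (h2.symm ▸ hg) h3 h4.1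
      exact ih _ v' k1 (k2.trans h2) k3 h4.2
  exact key p c [] trivial rfl hr hp

end LocallyConvex

/-! ### Bridges between two locally convex subcomplexes -/

variable (S) in
/-- `w₁ ++ w₀` is a geodesic from the vertex `b` of `B` to its gate `c` in `A`, whose part
`w₁` stays in `B`, and whose part `w₀`, the bridge, leaves `B` at a gate. -/
structure Bridge (A B : V → L → Prop) (w₀ : List L) (c b : V) (w₁ : List L) : Prop where
  walkIn : S.WalkIn B b w₁
  isWalk : S.IsWalk (S.dest b w₁) w₀
  dest_eq : S.dest (S.dest b w₁) w₀ = c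
  reduced : S.Reduced b (w₁ ++ w₀)
  gate_right : S.Gate B (S.dest b w₁) w₀
  gate_left : S.Gate A c (w₁ ++ w₀).reverse

namespace Bridge

variable {A B : V → L → Prop} {w₀ w₁ : List L} {b c : V}

theorem isWalk_append (hB : S.LocallyConvex B) (h : S.Bridge A B w₀ c b w₁) :
    S.IsWalk b (w₁ ++ w₀) :=
  SquareSystem.isWalk_append.2 ⟨hB.isWalk h.walkIn, h.isWalk⟩

theorem dest_append (h : S.Bridge A B w₀ c b w₁) : S.dest b (w₁ ++ w₀) = c := by
  rw [SquareSystem.dest_append, h.dest_eq]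

/-- When `b` moves along an edge of `B`, its gate `c` in `A` stays or moves along an edge of `A`,
and the bridge does not change. -/
theorem step (hA : S.LocallyConvex A) (hB : S.LocallyConvex B) (h : S.Bridge A B w₀ c b w₁)
    {a : L} (ha : B b a) :
    ∃ c' w₁', S.Bridge A B w₀ c' (S.mv b a) w₁' ∧ (c' = c ∨ A c a ∧ c' = S.mv c a) := by
  obtain ⟨v, h1, h2, h3, h4⟩ := hB.step h.walkIn h.gate_right h.reduced ha
  have hm := S.mv_mv (hB.ok ha)
  have hW := h.isWalk_append hB
  by_cases hg : S.Gate A c (v ++ w₀).reverse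
  · exact ⟨c, v, ⟨h1, h2 ▸ h.isWalk, h2 ▸ h.dest_eq, h3, h2 ▸ h.gate_right, hg⟩, .inl rfl⟩
  · simp only [Gate, not_forall, not_not] at hg
    obtain ⟨k, hk, hf⟩ := hg
    rcases h4 with rfl | h4
    · obtain ⟨s, t, h5, h6⟩ := hf
      rw [List.cons_append, List.reverse_cons] at h5
      rcases List.eq_nil_or_concat t with rfl | ⟨t, l, rfl⟩
      · -- the edge labelled `a` can be pushed along the whole geodesic into `A`
        obtain ⟨rfl, h7⟩ := List.append_inj' h5 rfl
        obtain rfl := List.singleton_injective h7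
        obtain ⟨hW1, hW2⟩ := hW.reverse
        rw [h.dest_append] at hW1 hW2
        have hc := h6.reverse
        rw [hW2, List.reverse_reverse] at hc
        obtain ⟨hc1, hc2⟩ := Cross.append.1 hc
        obtain ⟨hb1, hb2⟩ := hB.cross hc1 ha h.walkIn
        have hd : S.dest (S.mv b a) w₁ = S.mv (S.dest b w₁) a := hc1.dest_mv
        refine ⟨S.mv c a, w₁, ⟨hb2, ?_, ?_, ?_, ?_, hA.gate_mv h.gate_left h6 hk⟩, .inr ⟨hk, rfl⟩⟩
        · rw [hd]
          exact hc2.mv.isWalk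
        · rw [hd, hc2.dest_mv, h.dest_eq]
        · have he := hc.mv.eqv []
          rw [List.append_nil] at he
          exact (h3.eqv he.symm).left
        · rw [hd]
          exact hB.gate_mv h.gate_right hc2 hb1
      · rw [List.concat_eq_append, ← List.cons_append, ← List.append_assoc] at h5
        obtain ⟨h5, -⟩ := List.append_inj' h5 rfl
        exact (h.gate_left k hk ⟨s, t, h5, h6⟩).elim
    · have he := h4.reverse hW
      rw [h.dest_append, List.reverse_cons] at he
      exact (h.gate_left k hk ((hf.append [a]).eqv he.symm)).elim

theorem walk (hA : S.LocallyConvex A) (hB : S.LocallyConvex B) {P : V → Prop}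
    (hP : ∀ x a, P x → A x a → P (S.mv x a)) (h : S.Bridge A B w₀ c b w₁) (hc : P c)
    {p : List L} (hp : S.WalkIn B b p) :
    ∃ c' w₁', S.Bridge A B w₀ c' (S.dest b p) w₁' ∧ P c' := by
  induction p generalizing b c w₁ with
  | nil => exact ⟨c, w₁, h, hc⟩
  | cons a p ih =>
    obtain ⟨c', w₁', h1, h2⟩ := h.step hA hB hp.1
    refine ih h1 ?_ hp.2
    rcases h2 with rfl | ⟨h2, rfl⟩
    · exact hc
    · exact hP _ _ hc h2

/-- Every geodesic from a vertex of `B` to its gate in `A` contains a bridge, up to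
equivalence. -/
theorem exists_of_gate {w : List L} (hw : S.IsWalk b w)
    (hd : S.dest b w = c) (hr : S.Reduced b w) (hg : S.Gate A c w.reverse) :
    ∃ w₀ w₁, S.Bridge A B w₀ c b w₁ := by
  have key : ∀ (n : ℕ) (w₀ w₁ : List L), w₀.length = n → S.WalkIn B b w₁ →
      S.Eqv b w (w₁ ++ w₀) → ∃ w₀ w₁, S.Bridge A B w₀ c b w₁ := by
    intro n
    induction n with
    | zero =>
      intro w₀ w₁ hn h1 h2
      obtain rfl := List.length_eq_zero_iff.1 hn
      refine ⟨[], w₁, h1, trivial, ?_, hr.eqv h2, ?_, ?_⟩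
      · rw [← hd, h2.dest_eq, List.append_nil, dest]
      · rintro h - ⟨u, v, h3, -⟩
        simp at h3
      · intro k hk hf
        exact hg k hk (hf.eqv (by rw [← hd]; exact (h2.reverse hw).symm))
    | succ n ih =>
      intro w₀ w₁ hn h1 h2
      by_cases h3 : S.Gate B (S.dest b w₁) w₀
      · refine ⟨w₀, w₁, h1, (SquareSystem.isWalk_append.1 (h2.isWalk hw)).2, ?_, hr.eqv h2, h3, ?_⟩
        · rw [← hd, h2.dest_eq, SquareSystem.dest_append]
        · intro k hk hf
          exact hg k hk (hf.eqv (by rw [← hd]; exact (h2.reverse hw).symm))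
      · simp only [Gate, not_forall, not_not] at h3
        obtain ⟨k, hk, hf⟩ := h3
        obtain ⟨r, h4⟩ := front_iff.1 hf
        refine ih r (w₁ ++ [k]) ?_ (WalkIn.append.2 ⟨h1, hk, trivial⟩) (h2.trans ?_)
        · have := h4.length_eq
          simp only [List.length_cons] at this
          omega
        · simpa using h4.append_left
  exact key _ w [] rfl trivial (.refl _ _)

end Bridge

end SquareSystem

/-! ### Faces of cubes -/

namespace CubeMap

theorem ext {m n : ℕ} {f g : CubeMap m n} (h : ∀ x, f.toFun x = g.toFun x) : f = g := by
  obtain ⟨f, hf⟩ := f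
  obtain ⟨g, hg⟩ := g
  obtain rfl : f = g := funext h
  rfl

/-- The face of the `n`-cube through the vertex `v` in the directions `σ 0, …, σ (m - 1)`. -/
noncomputable def slice {m n : ℕ} (v : Fin n → Bool) (σ : Fin m ↪ Fin n) : CubeMap m n :=
  ⟨fun x => Function.extend σ x v, fun x y => by
    have h : (Finset.univ.filter fun j => Function.extend σ x v j ≠ Function.extend σ y v j) =
        (Finset.univ.filter fun j => x j ≠ y j).map σ := by
      ext j
      by_cases hj : ∃ k, σ k = j
      · obtain ⟨k, rfl⟩ := hj
        simp [σ.injective.extend_apply]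
      · simp only [Finset.mem_filter, Finset.mem_univ, true_and, Finset.mem_map,
          Function.extend_apply' _ _ _ hj, ne_eq, not_true_eq_false, false_iff]
        rintro ⟨k, -, hk⟩
        exact hj ⟨k, hk⟩
    simp only [hammingDist, h, Finset.card_map]⟩

/-- The symmetry of the `n`-cube that reflects the coordinates at which `r` is `true`. -/
def translate {n : ℕ} (r : Fin n → Bool) : CubeMap n n :=
  ⟨fun x i => xor (r i) (x i), fun x y => by simp only [hammingDist, ne_eq, Bool.xor_right_inj]⟩

theorem slice_comp_edge {m n : ℕ} (v : Fin n → Bool) (σ : Fin m ↪ Fin n) (w : Fin m → Bool)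
    (i : Fin m) : (slice v σ).comp (edge w i) = edge (Function.extend σ w v) (σ i) := by
  refine ext fun x => funext fun j => ?_
  by_cases hj : ∃ k, σ k = j
  · obtain ⟨k, rfl⟩ := hj
    simp [slice, comp, edge, σ.injective.extend_apply, Function.update_apply]
  · have hi : j ≠ σ i := fun h => hj ⟨i, h.symm⟩
    simp [slice, comp, edge, Function.extend_apply' _ _ _ hj, hi]

theorem translate_comp_edge {n : ℕ} (r w : Fin n → Bool) (i : Fin n) :
    (translate r).comp (edge w i) = edge (fun j => xor (r j) (w j)) i ∨
      (translate r).comp (edge w i) = (edge (fun j => xor (r j) (w j)) i).comp reflect := by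
  rcases hr : r i with _ | _
  · left
    refine ext fun x => funext fun j => ?_
    by_cases hj : j = i
    · subst hj
      simp [translate, comp, edge, hr]
    · simp [translate, comp, edge, hj]
  · right
    refine ext fun x => funext fun j => ?_
    by_cases hj : j = i
    · subst hj
      simp [translate, comp, edge, reflect, hr]
    · simp [translate, comp, edge, reflect, hj]

end CubeMap

/-- Every corner of a cube can be reached from the corner `0` by increasing one coordinate at a
time. -/
theorem boolCube_induction {n : ℕ} {P : (Fin n → Bool) → Prop} (h0 : P fun _ => false)
    (h1 : ∀ v i, v i = false → P v → P (Function.update v i true)) (v : Fin n → Bool) : P v := by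
  have key : ∀ s : Finset (Fin n), P fun i => decide (i ∈ s) := by
    intro s
    induction s using Finset.induction_on with
    | empty => simpa using h0
    | insert i s hi ih =>
      have := h1 _ i (by simpa using hi) ih
      convert this using 1
      funext j
      by_cases hj : j = i
      · subst hj
        simp
      · simp [hj]
  convert key (Finset.univ.filter fun i => v i = true) using 1
  funext i
  simp

namespace CubeComplex

section Basic

variable {K : CubeComplex.{u}}

theorem vertex_face {m n : ℕ} (f : CubeMap m n) (c : K.Cell n) (v : Fin m → Bool) :
    K.vertex (K.face f c) v = K.vertex c (f.toFun v) := by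
  unfold vertex
  rw [← K.face_comp]
  rfl

theorem vertex_cell_zero (c : K.Cell 0) (v : Fin 0 → Bool) : K.vertex c v = c := by
  have : CubeMap.vertex v = CubeMap.id 0 := CubeMap.ext fun _ => Subsingleton.elim _ _
  rw [vertex, this, K.face_id]

theorem source_edge {n : ℕ} (c : K.Cell n) (v : Fin n → Bool) (i : Fin n) :
    K.source (K.edge c v i) = K.vertex c (Function.update v i false) := vertex_face _ _ _

theorem target_edge {n : ℕ} (c : K.Cell n) (v : Fin n → Bool) (i : Fin n) :
    K.target (K.edge c v i) = K.vertex c (Function.update v i true) := vertex_face _ _ _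

theorem source_cornerEdge {n : ℕ} (c : K.Cell n) (i : Fin n) :
    K.source (K.cornerEdge c i) = K.corner c := by
  rw [cornerEdge, source_edge, Function.update_eq_self_iff.2 rfl, corner]

theorem source_flip (e : K.Cell 1) : K.source (K.flip e) = K.target e := vertex_face _ _ _

theorem target_flip (e : K.Cell 1) : K.target (K.flip e) = K.source e := vertex_face _ _ _

theorem dualHyperplane_flip (e : K.Cell 1) :
    K.dualHyperplane (K.flip e) = K.dualHyperplane e :=
  (Quot.sound (.inl rfl)).symm

theorem edge_slice {m n : ℕ} (c : K.Cell n) (v : Fin n → Bool) (σ : Fin m ↪ Fin n)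
    (w : Fin m → Bool) (i : Fin m) : K.edge (K.face (CubeMap.slice v σ) c) w i =
      K.edge c (Function.extend σ w v) (σ i) := by
  rw [edge, ← K.face_comp, CubeMap.slice_comp_edge, edge]

theorem cornerEdge_slice {m n : ℕ} (c : K.Cell n) (σ : Fin m ↪ Fin n) (i : Fin m) :
    K.cornerEdge (K.face (CubeMap.slice (fun _ => false) σ) c) i = K.cornerEdge c (σ i) := by
  rw [cornerEdge, edge_slice, cornerEdge]
  congr 1
  funext j
  by_cases hj : ∃ k, σ k = j
  · obtain ⟨k, rfl⟩ := hj
    rw [σ.injective.extend_apply]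
  · rw [Function.extend_apply' _ _ _ hj]

theorem corner_slice {m n : ℕ} (c : K.Cell n) (σ : Fin m ↪ Fin n) :
    K.corner (K.face (CubeMap.slice (fun _ => false) σ) c) = K.corner c := by
  rw [corner, vertex_face, corner]
  congr 1
  funext j
  by_cases hj : ∃ k, σ k = j
  · obtain ⟨k, rfl⟩ := hj
    simp [CubeMap.slice, σ.injective.extend_apply]
  · simp [CubeMap.slice, Function.extend_apply' _ _ _ hj]

theorem corner_translate {n : ℕ} (c : K.Cell n) (r : Fin n → Bool) :
    K.corner (K.face (CubeMap.translate r) c) = K.vertex c r := by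
  rw [corner, vertex_face]
  congr 1
  funext j
  simp [CubeMap.translate]

/-- The pair of directions `i`, `j` as an embedding of `Fin 2`. -/
def pairEmbedding {n : ℕ} (i j : Fin n) (h : i ≠ j) : Fin 2 ↪ Fin n :=
  ⟨![i, j], by
    intro a b hab
    fin_cases a <;> fin_cases b <;> simp_all [Ne.symm h]⟩

theorem pairEmbedding_zero {n : ℕ} (i j : Fin n) (h : i ≠ j) : pairEmbedding i j h 0 = i := rfl

theorem pairEmbedding_one {n : ℕ} (i j : Fin n) (h : i ≠ j) : pairEmbedding i j h 1 = j := rfl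

theorem edge_update_self {n : ℕ} (c : K.Cell n) (v : Fin n → Bool) (i : Fin n) (b : Bool) :
    K.edge c (Function.update v i b) i = K.edge c v i := by
  have : CubeMap.edge (Function.update v i b) i = CubeMap.edge v i :=
    CubeMap.ext fun x => by simp [CubeMap.edge]
  rw [edge, this, edge]

theorem dualHyperplane_edge_update {n : ℕ} (c : K.Cell n) (v : Fin n → Bool) (i j : Fin n)
    (hv : v j = false) : K.dualHyperplane (K.edge c (Function.update v j true) i) =
      K.dualHyperplane (K.edge c v i) := by
  by_cases h : j = i
  · subst h
    rw [edge_update_self]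
  · rw [← edge_update_self c v i false, ← edge_update_self c _ i false]
    refine (Quot.sound (.inr ⟨K.face (CubeMap.slice v (pairEmbedding i j (Ne.symm h))) c,
      ?_, ?_⟩)).symm
    · rw [edge_slice]
      congr 1
      funext k
      by_cases hk : ∃ l, pairEmbedding i j (Ne.symm h) l = k
      · rcases Fin.exists_fin_two.1 hk with rfl | rfl <;>
          rw [(pairEmbedding i j _).injective.extend_apply] <;>
          simp [pairEmbedding_zero, pairEmbedding_one, h, hv]
      · rw [Function.extend_apply' _ _ _ hk, Function.update_of_ne]
        rintro rfl
        exact hk ⟨0, rfl⟩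
    · rw [edge_slice]
      congr 1
      funext k
      by_cases hk : ∃ l, pairEmbedding i j (Ne.symm h) l = k
      · rcases Fin.exists_fin_two.1 hk with rfl | rfl <;>
          rw [(pairEmbedding i j _).injective.extend_apply] <;>
          simp [pairEmbedding_zero, pairEmbedding_one, h]
      · rw [Function.extend_apply' _ _ _ hk, Function.update_of_ne, Function.update_of_ne]
        · rintro rfl
          exact hk ⟨1, rfl⟩
        · rintro rfl
          exact hk ⟨0, rfl⟩

variable (K) in
/-- The hyperplane dual to the edges of the cube `c` in the `i`-th direction. -/
def dir {n : ℕ} (c : K.Cell n) (i : Fin n) : K.Hyperplane := K.dualHyperplane (K.cornerEdge c i)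

theorem dualHyperplane_edge {n : ℕ} (c : K.Cell n) (v : Fin n → Bool) (i : Fin n) :
    K.dualHyperplane (K.edge c v i) = K.dir c i := by
  induction v using boolCube_induction with
  | h0 => rfl
  | h1 v j hv ih => rw [dualHyperplane_edge_update c v i j hv, ih]

theorem dir_slice {m n : ℕ} (c : K.Cell n) (σ : Fin m ↪ Fin n) (i : Fin m) :
    K.dir (K.face (CubeMap.slice (fun _ => false) σ) c) i = K.dir c (σ i) := by
  rw [dir, cornerEdge_slice, dir]

theorem dir_translate {n : ℕ} (c : K.Cell n) (r : Fin n → Bool) (i : Fin n) :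
    K.dir (K.face (CubeMap.translate r) c) i = K.dir c i := by
  rw [dir, cornerEdge, edge, ← K.face_comp]
  rcases CubeMap.translate_comp_edge r (fun _ => false) i with h | h
  · rw [h]
    exact dualHyperplane_edge c _ i
  · rw [h, K.face_comp]
    exact (dualHyperplane_flip _).trans (dualHyperplane_edge c _ i)

theorem FormCorner.symm {e f : K.Cell 1} (h : K.FormCorner e f) : K.FormCorner f e := by
  obtain ⟨s, rfl, rfl⟩ := h
  exact ⟨K.face (CubeMap.slice (fun _ => false) (pairEmbedding 1 0 (by decide))) s,
    cornerEdge_slice _ _ _, cornerEdge_slice _ _ _⟩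

theorem isPath_append {x y : K.Cell 0} {l l' : List (K.Cell 1)} :
    K.IsPath x (l ++ l') y ↔ ∃ z, K.IsPath x l z ∧ K.IsPath z l' y := by
  induction l generalizing x with
  | nil => simp [IsPath]
  | cons e l ih => simp only [List.cons_append, IsPath, ih, ← exists_and_left, and_assoc]

/-- In a weakly special cube complex, edges that start at the same vertex are dual to different
hyperplanes. -/
theorem WeaklySpecial.eq_of_dualHyperplane (hs : K.WeaklySpecial) {e f : K.Cell 1}
    (h : K.source e = K.source f) (h' : K.dualHyperplane e = K.dualHyperplane f) : e = f := by
  by_contra hne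
  by_cases hflip : e = K.flip f
  · refine hs.not_selfOsculates _ (.inr ⟨f, rfl, ?_⟩)
    rw [← h, hflip, source_flip]
  · by_cases hc : K.FormCorner e f
    · exact hs.not_selfIntersects _ ⟨e, f, h, hne, hflip, h', rfl, hc⟩
    · exact hs.not_selfOsculates _ (.inl ⟨e, f, h, hne, hflip, h', rfl, hc⟩)

end Basic

/-! ### The cover as a square system -/

section Cover

variable {X : CubeComplex.{u}} {U : CubeComplex.{v}} {p : Hom U X}

theorem Hom.map_corner (p : Hom U X) {n : ℕ} (c : U.Cell n) :
    p.map (U.corner c) = X.corner (p.map c) := p.map_face _ _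

theorem Hom.map_edge (p : Hom U X) {n : ℕ} (c : U.Cell n) (v : Fin n → Bool) (i : Fin n) :
    p.map (U.edge c v i) = X.edge (p.map c) v i := p.map_face _ _

theorem Hom.map_source (p : Hom U X) (e : U.Cell 1) :
    p.map (U.source e) = X.source (p.map e) := p.map_face _ _

theorem Hom.map_target (p : Hom U X) (e : U.Cell 1) :
    p.map (U.target e) = X.target (p.map e) := p.map_face _ _

/-- The label of an edge of the cover: the hyperplane of the base that is dual to its image. -/
def Hom.label (p : Hom U X) (e : U.Cell 1) : X.Hyperplane := X.dualHyperplane (p.map e)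

theorem Hom.label_edge (p : Hom U X) {n : ℕ} (c : U.Cell n) (v : Fin n → Bool) (i : Fin n) :
    p.label (U.edge c v i) = X.dir (p.map c) i := by
  rw [Hom.label, p.map_edge, dualHyperplane_edge]

theorem Hom.label_flip (p : Hom U X) (e : U.Cell 1) : p.label (U.flip e) = p.label e := by
  have : p.map (U.flip e) = X.flip (p.map e) := p.map_face _ _
  rw [Hom.label, this, dualHyperplane_flip, Hom.label]

theorem Hom.IsCovering.eq_of_corner (hp : p.IsCovering) {n : ℕ} {c d : U.Cell n}
    (h : U.corner c = U.corner d) (h' : p.map c = p.map d) : c = d :=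
  (hp n (U.corner d) (p.map d) (p.map_corner d).symm).unique ⟨h, h'⟩ ⟨rfl, rfl⟩

theorem Hom.IsCovering.eq_of_label (hp : p.IsCovering) (hs : X.WeaklySpecial) {e f : U.Cell 1}
    (h : U.source e = U.source f) (h' : p.label e = p.label f) : e = f :=
  hp.eq_of_corner h (hs.eq_of_dualHyperplane (by rw [← p.map_source, h, p.map_source]) h')

open Classical in
/-- The other end of the edge with label `a` at `x`, or `x` if there is none. -/
noncomputable def Hom.move (p : Hom U X) (x : U.Cell 0) (a : X.Hyperplane) : U.Cell 0 :=
  if h : ∃ e, U.source e = x ∧ p.label e = a then U.target h.choose else x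

theorem Hom.IsCovering.move_eq (hp : p.IsCovering) (hs : X.WeaklySpecial) (e : U.Cell 1) :
    p.move (U.source e) (p.label e) = U.target e := by
  have h : ∃ f, U.source f = U.source e ∧ p.label f = p.label e := ⟨e, rfl, rfl⟩
  rw [Hom.move, dif_pos h, hp.eq_of_label hs h.choose_spec.1 h.choose_spec.2]

theorem Hom.IsCovering.move_vertex (hp : p.IsCovering) (hs : X.WeaklySpecial) {n : ℕ}
    (c : U.Cell n) (v : Fin n → Bool) (i : Fin n) (hv : v i = false) :
    p.move (U.vertex c v) (X.dir (p.map c) i) = U.vertex c (Function.update v i true) := by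
  have := hp.move_eq hs (U.edge c v i)
  rwa [source_edge, Function.update_eq_self_iff.2 hv.symm, target_edge, p.label_edge] at this

/-- There is a square with labels `a` and `b` at the corner `x`. -/
def Hom.HasSquare (p : Hom U X) (x : U.Cell 0) (a b : X.Hyperplane) : Prop :=
  ∃ s : U.Cell 2, U.corner s = x ∧ X.dir (p.map s) 0 = a ∧ X.dir (p.map s) 1 = b

theorem Hom.hasSquare_vertex (p : Hom U X) {n : ℕ} (c : U.Cell n) (v : Fin n → Bool)
    {i j : Fin n} (h : i ≠ j) :
    p.HasSquare (U.vertex c v) (X.dir (p.map c) i) (X.dir (p.map c) j) := by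
  refine ⟨U.face (CubeMap.slice (fun _ => false) (pairEmbedding i j h))
    (U.face (CubeMap.translate v) c), ?_, ?_, ?_⟩
  · rw [corner_slice, corner_translate]
  · rw [p.map_face, p.map_face, dir_slice, dir_translate]
    rfl
  · rw [p.map_face, p.map_face, dir_slice, dir_translate]
    rfl

theorem Hom.hasSquare_cube (hp : p.IsCovering) (hs : X.WeaklySpecial) {x : U.Cell 0}
    {a b c : X.Hyperplane} (hab : p.HasSquare x a b) (hac : p.HasSquare x a c)
    (hbc : p.HasSquare x b c) : p.HasSquare (p.move x a) b c := by
  obtain ⟨s, rfl, rfl, rfl⟩ := hab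
  obtain ⟨t, ht, ht0, rfl⟩ := hac
  obtain ⟨r, hr, hr0, hr1⟩ := hbc
  have ht' : X.corner (p.map t) = X.corner (p.map s) := by
    rw [← p.map_corner, ht, p.map_corner]
  have hr' : X.corner (p.map r) = X.corner (p.map s) := by
    rw [← p.map_corner, hr, p.map_corner]
  have e1 : X.cornerEdge (p.map t) 0 = X.cornerEdge (p.map s) 0 :=
    hs.eq_of_dualHyperplane (by rw [source_cornerEdge, source_cornerEdge, ht']) ht0
  have e2 : X.cornerEdge (p.map r) 0 = X.cornerEdge (p.map s) 1 :=
    hs.eq_of_dualHyperplane (by rw [source_cornerEdge, source_cornerEdge, hr']) hr0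
  have e3 : X.cornerEdge (p.map r) 1 = X.cornerEdge (p.map t) 1 :=
    hs.eq_of_dualHyperplane (by rw [source_cornerEdge, source_cornerEdge, hr', ht']) hr1
  have f1 : X.FormCorner (X.cornerEdge (p.map s) 0) (X.cornerEdge (p.map s) 1) := ⟨_, rfl, rfl⟩
  have f2 : X.FormCorner (X.cornerEdge (p.map s) 0) (X.cornerEdge (p.map t) 1) := ⟨_, e1, rfl⟩
  have f3 : X.FormCorner (X.cornerEdge (p.map s) 1) (X.cornerEdge (p.map t) 1) := ⟨_, e2, e3⟩
  have hne : ∀ {e f : X.Cell 1}, X.FormCorner e f → e ≠ f := by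
    rintro e f ⟨q, rfl, rfl⟩ h
    exact absurd (hs.nonPositivelyCurved.cornerEdge_injective q h) (by decide)
  obtain ⟨d, hd, hd'⟩ := hs.nonPositivelyCurved.flag (X.corner (p.map s))
    ![X.cornerEdge (p.map s) 0, X.cornerEdge (p.map s) 1, X.cornerEdge (p.map t) 1]
    (by
      intro i j hij
      fin_cases i <;> fin_cases j <;>
        simp_all [hne f1, hne f2, hne f3, (hne f1).symm, (hne f2).symm, (hne f3).symm])
    (by
      intro i
      fin_cases i
      · exact source_cornerEdge _ _
      · exact source_cornerEdge _ _
      · exact (source_cornerEdge _ _).trans ht')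
    (by
      intro i j hij
      fin_cases i <;> fin_cases j
      exacts [absurd rfl hij, f1, f2, f1.symm, absurd rfl hij, f3, f2.symm, f3.symm,
        absurd rfl hij])
  obtain ⟨k, ⟨hk, rfl⟩, -⟩ := hp 3 (U.corner s) d (by rw [hd, p.map_corner])
  have g0 : X.dir (p.map k) 0 = X.dir (p.map s) 0 := congrArg _ (hd' 0)
  have g1 : X.dir (p.map k) 1 = X.dir (p.map s) 1 := congrArg _ (hd' 1)
  have g2 : X.dir (p.map k) 2 = X.dir (p.map t) 1 := congrArg _ (hd' 2)
  rw [← g0, ← g1, ← g2, ← hk, corner, hp.move_vertex hs k _ 0 rfl]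
  exact p.hasSquare_vertex k _ (by decide)

/-- The `2`-skeleton of a cover of a weakly special cube complex, with the edges labelled by the
hyperplanes of the base. -/
noncomputable def Hom.IsCovering.squareSystem (hp : p.IsCovering) (hs : X.WeaklySpecial) :
    SquareSystem (U.Cell 0) X.Hyperplane where
  ok x a := ∃ e, U.source e = x ∧ p.label e = a
  mv := p.move
  sq := p.HasSquare
  ok_mv := by
    rintro x a ⟨e, rfl, rfl⟩
    exact ⟨U.flip e, by rw [source_flip, hp.move_eq hs], p.label_flip e⟩
  mv_mv := by
    rintro x a ⟨e, rfl, rfl⟩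
    rw [hp.move_eq hs, ← p.label_flip, ← source_flip, hp.move_eq hs, target_flip]
  sq_ok := by
    rintro x a b ⟨s, rfl, rfl, rfl⟩
    exact ⟨U.cornerEdge s 0, source_cornerEdge _ _, p.label_edge _ _ _⟩
  sq_ne := by
    rintro x a b ⟨s, rfl, rfl, rfl⟩ h
    have := hs.eq_of_dualHyperplane (by rw [source_cornerEdge, source_cornerEdge]) h
    exact absurd (hs.nonPositivelyCurved.cornerEdge_injective _ this) (by decide)
  sq_symm := by
    rintro x a b ⟨s, rfl, rfl, rfl⟩
    exact p.hasSquare_vertex s _ (by decide)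
  sq_mv := by
    rintro x a b ⟨s, rfl, rfl, rfl⟩
    rw [corner, hp.move_vertex hs s _ 0 rfl]
    exact p.hasSquare_vertex s _ (by decide)
  mv_comm := by
    rintro x a b ⟨s, rfl, rfl, rfl⟩
    rw [corner, hp.move_vertex hs s _ 0 rfl, hp.move_vertex hs s _ 1 rfl,
      hp.move_vertex hs s _ 1 rfl, hp.move_vertex hs s _ 0 rfl, Function.update_comm (by decide)]
  cube := Hom.hasSquare_cube hp hs

variable (hp : p.IsCovering) (hs : X.WeaklySpecial)

theorem isWalk_of_isPath {x y : U.Cell 0} {l : List (U.Cell 1)} (h : U.IsPath x l y) :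
    (hp.squareSystem hs).IsWalk x (l.map p.label) ∧
      (hp.squareSystem hs).dest x (l.map p.label) = y := by
  induction l generalizing x with
  | nil => exact ⟨trivial, h⟩
  | cons e l ih =>
    obtain ⟨rfl, h⟩ := h
    obtain ⟨h1, h2⟩ := ih h
    have hm : (hp.squareSystem hs).mv (U.source e) (p.label e) = U.target e := hp.move_eq hs e
    rw [List.map_cons, SquareSystem.IsWalk, SquareSystem.dest, hm]
    exact ⟨⟨⟨e, rfl, rfl⟩, h1⟩, h2⟩

theorem exists_isPath {x : U.Cell 0} {w : List X.Hyperplane}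
    (h : (hp.squareSystem hs).IsWalk x w) :
    ∃ l, U.IsPath x l ((hp.squareSystem hs).dest x w) ∧ l.map p.label = w := by
  induction w generalizing x with
  | nil => exact ⟨[], rfl, rfl⟩
  | cons a w ih =>
    obtain ⟨⟨e, rfl, rfl⟩, h⟩ := h
    have hm : (hp.squareSystem hs).mv (U.source e) (p.label e) = U.target e := hp.move_eq hs e
    rw [SquareSystem.dest]
    rw [hm] at h ⊢
    obtain ⟨l, h1, h2⟩ := ih h
    exact ⟨e :: l, ⟨rfl, h1⟩, by rw [List.map_cons, h2]⟩

theorem nfEq_of_homotopyStep {x y : U.Cell 0} {l l' : List (U.Cell 1)} (hl : U.IsPath x l y)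
    (hl' : U.IsPath x l' y) (h : U.HomotopyStep l l') :
    (hp.squareSystem hs).NFEq x (l.map p.label) (l'.map p.label) := by
  cases h with
  | backtrack l₁ e l₂ =>
    have h1 := (isWalk_of_isPath hp hs hl).1
    have h2 := (isWalk_of_isPath hp hs hl').1
    simp only [List.map_append, List.map_cons, p.label_flip, SquareSystem.isWalk_append,
      SquareSystem.IsWalk] at h1 h2 ⊢
    exact .append_left _ (SquareSystem.NFEq.backtrack h2.2.1 h1.2).symm
  | square l₁ s l₂ =>
    have h1 := (isWalk_of_isPath hp hs hl).1
    obtain ⟨z, hz, hz', -⟩ := isPath_append.1 hl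
    simp only [List.map_append, List.map_cons, p.label_edge, SquareSystem.isWalk_append,
      SquareSystem.IsWalk] at h1 ⊢
    refine .append_left _ (SquareSystem.NFEq.swap (show p.HasSquare _ _ _ from ⟨s, ?_, rfl, rfl⟩)
      h1.2.2.2)
    rw [(isWalk_of_isPath hp hs hz).2, ← hz', source_edge, corner]
    congr 1
    funext i
    fin_cases i <;> rfl

theorem loopsContract (hU : U.SimplyConnected) : (hp.squareSystem hs).LoopsContract := by
  intro x w hw hd
  obtain ⟨l, h1, rfl⟩ := exists_isPath hp hs hw
  rw [hd] at h1
  have key : ∀ {l l' : List (U.Cell 1)}, U.Homotopic x x l l' →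
      (hp.squareSystem hs).NFEq x (l.map p.label) (l'.map p.label) := by
    intro l l' h
    induction h with
    | rel l l' h => exact nfEq_of_homotopyStep hp hs h.1 h.2.1 h.2.2
    | refl l => exact .refl _ _
    | symm _ _ _ ih => exact ih.symm
    | trans _ _ _ _ _ ih ih' => exact ih.trans ih'
  exact (key (hU.2 x l h1) []).2 (.nil x)

theorem exists_reduced_walk (hU : U.SimplyConnected) (x y : U.Cell 0) :
    ∃ w, (hp.squareSystem hs).IsWalk x w ∧ (hp.squareSystem hs).dest x w = y ∧
      (hp.squareSystem hs).Reduced x w := by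
  obtain ⟨l, hl⟩ := hU.1.2 x y
  obtain ⟨h1, h2⟩ := isWalk_of_isPath hp hs hl
  obtain ⟨r, hr⟩ := SquareSystem.NF.exists_of_isWalk h1
  exact ⟨r, hr.isWalk_right, hr.dest_eq ▸ h2, hr.reduced⟩

/-- Reduced walks are geodesics. -/
theorem dist_eq (hU : U.SimplyConnected) {x : U.Cell 0} {w : List X.Hyperplane}
    (hw : (hp.squareSystem hs).IsWalk x w) (hr : (hp.squareSystem hs).Reduced x w) :
    U.dist x ((hp.squareSystem hs).dest x w) = w.length := by
  obtain ⟨l, h1, h2⟩ := exists_isPath hp hs hw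
  have hmem : w.length ∈ {k : ℕ | ∃ l, U.IsPath x l ((hp.squareSystem hs).dest x w) ∧
      l.length = k} := ⟨l, h1, by rw [← h2, List.length_map]⟩
  refine le_antisymm (Nat.sInf_le hmem) (le_csInf ⟨_, hmem⟩ ?_)
  rintro k ⟨l, hl, rfl⟩
  obtain ⟨k1, k2⟩ := isWalk_of_isPath hp hs hl
  obtain ⟨r, hn⟩ := SquareSystem.NF.exists_of_isWalk k1
  have he := (loopsContract hp hs hU).eqv hw hn.isWalk_right (by rw [← hn.dest_eq, k2]) hr
    hn.reduced
  rw [he.length_eq, ← List.length_map p.label]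
  exact hn.length_le

/-! ### Deck transformations -/

/-- Vertices with the same image in the base have the same labels and squares. -/
theorem bisimulation :
    (hp.squareSystem hs).Bisimulation fun x y : U.Cell 0 => p.map x = p.map y := by
  have lift : ∀ {x y : U.Cell 0} {n : ℕ} (c : U.Cell n), p.map x = p.map y → U.corner c = x →
      ∃ d : U.Cell n, U.corner d = y ∧ p.map d = p.map c := by
    rintro x y n c h rfl
    exact (hp n y (p.map c) (by rw [← p.map_corner, h])).exists
  have ok : ∀ {x y : U.Cell 0} {a : X.Hyperplane}, p.map x = p.map y →
      (∃ e, U.source e = x ∧ p.label e = a) → ∃ e, U.source e = y ∧ p.label e = a := by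
    rintro x y a h ⟨e, he, rfl⟩
    obtain ⟨d, h1, h2⟩ := lift e h he
    exact ⟨d, h1, congrArg X.dualHyperplane h2⟩
  refine ⟨Eq.symm, ok, ?_, ?_⟩
  · rintro x y a b h ⟨s, h0, rfl, rfl⟩
    obtain ⟨d, h1, h2⟩ := lift s h h0
    exact ⟨d, h1, by rw [h2], by rw [h2]⟩
  · intro x y a h
    change p.map (p.move x a) = p.map (p.move y a)
    by_cases hx : ∃ e, U.source e = x ∧ p.label e = a
    · obtain ⟨e, rfl, rfl⟩ := hx
      obtain ⟨d, rfl, h2⟩ := lift e h rfl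
      have h3 : p.label d = p.label e := congrArg X.dualHyperplane h2
      have h4 := hp.move_eq hs d
      rw [h3] at h4
      change p.map _ = p.map (p.move (U.source d) _)
      rw [hp.move_eq hs, h4, p.map_target, p.map_target, h2]
    · have hy : ¬ ∃ e, U.source e = y ∧ p.label e = a := fun k => hx (ok h.symm k)
      rw [Hom.move, Hom.move, dif_neg hx, dif_neg hy, h]

/-- The deck transformations of a simply connected cover act transitively on the fibres. -/
theorem exists_deck (hp : p.IsCovering) (hs : X.WeaklySpecial) (hU : U.SimplyConnected)
    {x y : U.Cell 0} (h : p.map x = p.map y) :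
    ∃ g ∈ p.deck, g 0 x = y := by
  have hl := loopsContract hp hs hU
  have hR := bisimulation hp hs
  choose W hW1 hW2 _ using exists_reduced_walk hp hs hU
  -- a vertex is moved by following from `y` the labels of a walk from `x`
  let φ : U.Cell 0 → U.Cell 0 → U.Cell 0 → U.Cell 0 := fun x y z =>
    (hp.squareSystem hs).dest y (W x z)
  have hφ : ∀ {x y : U.Cell 0}, p.map x = p.map y → ∀ {w : List X.Hyperplane},
      (hp.squareSystem hs).IsWalk x w →
      φ x y ((hp.squareSystem hs).dest x w) = (hp.squareSystem hs).dest y w := by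
    intro x y h w hw
    exact hR.dest_eq hl h (hW1 _ _) hw (hW2 _ _)
  have hpφ : ∀ {x y : U.Cell 0}, p.map x = p.map y → ∀ z, p.map (φ x y z) = p.map z := by
    intro x y h z
    have := hR.dest h (W x z)
    rw [hW2] at this
    exact this.symm
  have hφφ : ∀ {x y : U.Cell 0}, p.map x = p.map y → ∀ z, φ y x (φ x y z) = z := by
    intro x y h z
    rw [hφ h.symm (hR.isWalk h (hW1 x z)), hW2]
  have hmove : ∀ {x y : U.Cell 0}, p.map x = p.map y → ∀ e : U.Cell 1,
      φ x y (U.target e) = p.move (φ x y (U.source e)) (p.label e) := by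
    intro x y h e
    have hw : (hp.squareSystem hs).IsWalk x (W x (U.source e) ++ [p.label e]) :=
      SquareSystem.isWalk_append.2 ⟨hW1 _ _, ⟨e, (hW2 _ _).symm, rfl⟩, trivial⟩
    have := hφ h hw
    rw [SquareSystem.dest_append, SquareSystem.dest_append, hW2] at this
    have hm : (hp.squareSystem hs).dest (U.source e) [p.label e] = U.target e := hp.move_eq hs e
    rw [hm] at this
    exact this
  have hlift : ∀ {x y : U.Cell 0}, p.map x = p.map y → ∀ (n : ℕ) (c : U.Cell n),
      ∃ d : U.Cell n, U.corner d = φ x y (U.corner c) ∧ p.map d = p.map c := by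
    intro x y h n c
    exact (hp n (φ x y (U.corner c)) (p.map c) (by rw [hpφ h, p.map_corner])).exists
  -- a cube is moved by moving its corner; all its vertices are then moved in the same way
  have hvert : ∀ {x y : U.Cell 0}, p.map x = p.map y → ∀ {n : ℕ} {c d : U.Cell n},
      U.corner d = φ x y (U.corner c) → p.map d = p.map c → ∀ v,
      U.vertex d v = φ x y (U.vertex c v) := by
    intro x y h n c d h1 h2 v
    induction v using boolCube_induction with
    | h0 => exact h1
    | h1 v i hv ih =>
      have h3 := hmove h (U.edge c v i)
      have hv' : Function.update v i false = v := Function.update_eq_self_iff.2 hv.symm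
      rw [target_edge, source_edge, hv', p.label_edge, ← ih, ← h2,
        hp.move_vertex hs d v i hv] at h3
      exact h3.symm
  choose G hG1 hG2 using @hlift
  have hGG : ∀ {x y : U.Cell 0} (h : p.map x = p.map y) (n : ℕ) (c : U.Cell n),
      G h.symm n (G h n c) = c := by
    intro x y h n c
    refine hp.eq_of_corner ?_ (by rw [hG2, hG2])
    rw [hG1, hG1, hφφ h]
  refine ⟨fun n => ⟨G h n, G h.symm n, hGG h n, hGG h.symm n⟩, ⟨fun {m n} f c => ?_,
    fun c => hG2 h _ c⟩, ?_⟩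
  · refine hp.eq_of_corner ?_ ?_
    · change U.corner (G h m (U.face f c)) = U.corner (U.face f (G h n c))
      rw [hG1, corner, vertex_face, corner, vertex_face,
        hvert h (hG1 h n c) (hG2 h n c)]
    · change p.map (G h m (U.face f c)) = p.map (U.face f (G h n c))
      rw [hG2, p.map_face, p.map_face, hG2]
  · change G h 0 x = y
    have h1 := hG1 h 0 x
    rw [corner, vertex_cell_zero, corner, vertex_cell_zero] at h1
    rw [h1]
    exact hφ h (w := []) trivial

end Cover

end CubeComplex

namespace CubeComplex

variable {X : CubeComplex.{u}} {U : CubeComplex.{v}} {p : Hom U X}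

/-! ### Action of deck transformations on walks and distances -/

section Deck

theorem Hom.deck_source {g : ∀ n : ℕ, Equiv.Perm (U.Cell n)} (hg : g ∈ p.deck) (e : U.Cell 1) :
    U.source (g 1 e) = g 0 (U.source e) := (hg.1 _ _).symm

theorem Hom.deck_target {g : ∀ n : ℕ, Equiv.Perm (U.Cell n)} (hg : g ∈ p.deck) (e : U.Cell 1) :
    U.target (g 1 e) = g 0 (U.target e) := (hg.1 _ _).symm

theorem Hom.deck_isPath {g : ∀ n : ℕ, Equiv.Perm (U.Cell n)} (hg : g ∈ p.deck)
    {x y : U.Cell 0} {l : List (U.Cell 1)} (h : U.IsPath x l y) :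
    U.IsPath (g 0 x) (l.map (g 1)) (g 0 y) := by
  induction l generalizing x with
  | nil => exact congrArg _ h
  | cons e l ih =>
    obtain ⟨rfl, h⟩ := h
    refine ⟨Hom.deck_source hg e, ?_⟩
    rw [Hom.deck_target hg]
    exact ih h

theorem Hom.deck_dist {g : ∀ n : ℕ, Equiv.Perm (U.Cell n)} (hg : g ∈ p.deck)
    (x y : U.Cell 0) : U.dist (g 0 x) (g 0 y) = U.dist x y := by
  have key : ∀ {g : ∀ n : ℕ, Equiv.Perm (U.Cell n)}, g ∈ p.deck → ∀ {x y : U.Cell 0} {k : ℕ},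
      (∃ l, U.IsPath x l y ∧ l.length = k) → ∃ l, U.IsPath (g 0 x) l (g 0 y) ∧ l.length = k := by
    rintro g hg x y k ⟨l, h, rfl⟩
    exact ⟨l.map (g 1), Hom.deck_isPath hg h, List.length_map _⟩
  unfold dist
  congr 1
  ext k
  refine ⟨fun h => ?_, key hg⟩
  simpa using key (inv_mem hg) h

theorem Hom.deck_vertex {g : ∀ n : ℕ, Equiv.Perm (U.Cell n)} (hg : g ∈ p.deck) {n : ℕ}
    (c : U.Cell n) (v : Fin n → Bool) : U.vertex (g n c) v = g 0 (U.vertex c v) :=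
  (hg.1 _ _).symm

theorem Hom.deck_dest (hp : p.IsCovering) (hs : X.WeaklySpecial)
    {g : ∀ n : ℕ, Equiv.Perm (U.Cell n)} (hg : g ∈ p.deck) {x : U.Cell 0}
    {w : List X.Hyperplane} (hw : (hp.squareSystem hs).IsWalk x w) :
    g 0 ((hp.squareSystem hs).dest x w) = (hp.squareSystem hs).dest (g 0 x) w := by
  obtain ⟨l, h1, rfl⟩ := exists_isPath hp hs hw
  have := (isWalk_of_isPath hp hs (Hom.deck_isPath hg h1)).2
  have hl : (l.map (g 1)).map p.label = l.map p.label := by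
    rw [List.map_map]
    exact List.map_congr_left fun e _ => congrArg X.dualHyperplane (hg.2 e)
  rw [hl] at this
  exact this.symm

end Deck

namespace Subcomplex

/-! ### Components of subcomplexes -/

/-- The vertices `x` and `y` are joined by an edge path in the subcomplex `A`. -/
def Joined (A : U.Subcomplex) (x y : U.Cell 0) : Prop :=
  ∃ l, U.IsPath x l y ∧ ∀ e ∈ l, e ∈ A.cells 1

theorem Joined.refl (A : U.Subcomplex) (x : U.Cell 0) : A.Joined x x := ⟨[], rfl, by simp⟩

theorem Joined.trans {A : U.Subcomplex} {x y z : U.Cell 0} (h : A.Joined x y)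
    (h' : A.Joined y z) : A.Joined x z := by
  obtain ⟨l, h1, h2⟩ := h
  obtain ⟨l', h3, h4⟩ := h'
  refine ⟨l ++ l', isPath_append.2 ⟨y, h1, h3⟩, fun e he => ?_⟩
  rcases List.mem_append.1 he with he | he
  · exact h2 e he
  · exact h4 e he

theorem joined_of_edge {A : U.Subcomplex} {e : U.Cell 1} (he : e ∈ A.cells 1) :
    A.Joined (U.source e) (U.target e) := ⟨[e], ⟨rfl, rfl⟩, by simpa using he⟩

theorem Joined.symm {A : U.Subcomplex} {x y : U.Cell 0} (h : A.Joined x y) : A.Joined y x := by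
  obtain ⟨l, h1, h2⟩ := h
  induction l generalizing x with
  | nil =>
    obtain rfl : x = y := h1
    exact .refl A x
  | cons e l ih =>
    obtain ⟨rfl, h1⟩ := h1
    have := joined_of_edge (A.face_mem CubeMap.reflect (h2 e (by simp)))
    change A.Joined (U.source (U.flip e)) (U.target (U.flip e)) at this
    rw [source_flip, target_flip] at this
    exact (ih h1 fun f hf => h2 f (by simp [hf])).trans this

theorem joined_vertex {A : U.Subcomplex} {n : ℕ} {c : U.Cell n} (hc : c ∈ A.cells n)
    (v : Fin n → Bool) : A.Joined (U.corner c) (U.vertex c v) := by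
  induction v using boolCube_induction with
  | h0 => exact .refl _ _
  | h1 v i hv ih =>
    have h : A.Joined (U.source (U.edge c v i)) (U.target (U.edge c v i)) :=
      joined_of_edge (A.face_mem _ hc)
    have hv' : Function.update v i false = v := Function.update_eq_self_iff.2 hv.symm
    rw [source_edge, target_edge, hv'] at h
    exact ih.trans h

theorem mem_component_iff {A : U.Subcomplex} {x : U.Cell 0} {n : ℕ} {c : U.Cell n} :
    c ∈ (A.component x).cells n ↔ c ∈ A.cells n ∧ A.Joined x (U.corner c) :=
  ⟨fun h => ⟨h.1, h.2 _⟩, fun h => ⟨h.1, fun v => h.2.trans (joined_vertex h.1 v)⟩⟩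

theorem mem_component_zero {A : U.Subcomplex} {x y : U.Cell 0} :
    y ∈ (A.component x).cells 0 ↔ y ∈ A.cells 0 ∧ A.Joined x y := by
  rw [mem_component_iff, corner, vertex_cell_zero]

theorem corner_mem {A : U.Subcomplex} {n : ℕ} {c : U.Cell n} (hc : c ∈ A.cells n) :
    U.corner c ∈ A.cells 0 := A.face_mem _ hc

/-! ### Elevations -/

variable {A B : X.Subcomplex} {A' B' : U.Subcomplex}

theorem IsElevation.nonempty (h : IsElevation p A A') : (A'.cells 0).Nonempty := by
  obtain ⟨x, hx, rfl⟩ := h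
  exact ⟨x, mem_component_zero.2 ⟨hx, .refl _ _⟩⟩

theorem IsElevation.locallyConvex (hA : A.LocallyConvex) (h : IsElevation p A A') :
    A'.LocallyConvex := by
  obtain ⟨x, hx, rfl⟩ := h
  intro n c hc he
  rw [mem_component_zero] at hc
  refine mem_component_iff.2 ⟨hA (p.map c) ?_ fun i => ?_, hc.2⟩
  · rw [← p.map_corner]
    exact hc.1
  · have := (he i).1
    change p.map (U.edge c _ i) ∈ A.cells 1 at this
    rwa [p.map_edge] at this

/-- The edges of a subcomplex of the cover, in terms of their labels. -/
def edges (p : Hom U X) (A' : U.Subcomplex) (x : U.Cell 0) (a : X.Hyperplane) : Prop :=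
  ∃ e ∈ A'.cells 1, U.source e = x ∧ p.label e = a

theorem mv_mem (hp : p.IsCovering) (hs : X.WeaklySpecial) {x : U.Cell 0}
    {a : X.Hyperplane} (h : A'.edges p x a) : (hp.squareSystem hs).mv x a ∈ A'.cells 0 := by
  obtain ⟨e, he, rfl, rfl⟩ := h
  change p.move _ _ ∈ _
  rw [hp.move_eq hs]
  exact A'.face_mem _ he

theorem locallyConvex_edges (hp : p.IsCovering) (hs : X.WeaklySpecial)
    (hA : A'.LocallyConvex) : (hp.squareSystem hs).LocallyConvex (A'.edges p) where
  ok := by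
    rintro x a ⟨e, -, h⟩
    exact ⟨e, h⟩
  mv := by
    rintro x a ⟨e, he, rfl, rfl⟩
    refine ⟨U.flip e, A'.face_mem _ he, ?_, p.label_flip e⟩
    rw [source_flip]
    exact (hp.move_eq hs e).symm
  sq := by
    rintro x a b ⟨s, rfl, rfl, rfl⟩ ⟨e, he, he1, he2⟩ ⟨f, hf, hf1, hf2⟩
    obtain rfl : e = U.cornerEdge s 0 := hp.eq_of_label hs (by rw [he1, source_cornerEdge])
      (by rw [he2, cornerEdge, p.label_edge])
    obtain rfl : f = U.cornerEdge s 1 := hp.eq_of_label hs (by rw [hf1, source_cornerEdge])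
      (by rw [hf2, cornerEdge, p.label_edge])
    have hmem : s ∈ A'.cells 2 := by
      refine hA s ?_ (Fin.forall_fin_two.2 ⟨he, hf⟩)
      rw [← source_cornerEdge s 0]
      exact A'.face_mem _ he
    refine ⟨U.edge s (Function.update (fun _ => false) 0 true) 1, A'.face_mem _ hmem, ?_,
      p.label_edge _ _ _⟩
    rw [source_edge]
    refine Eq.trans ?_ (hp.move_vertex hs s _ 0 rfl).symm
    rw [Function.update_eq_self_iff.2]
    rfl

theorem mem_of_walkIn (hp : p.IsCovering) (hs : X.WeaklySpecial) {x : U.Cell 0}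
    {w : List X.Hyperplane} (hx : x ∈ A'.cells 0)
    (hw : (hp.squareSystem hs).WalkIn (A'.edges p) x w) :
    (hp.squareSystem hs).dest x w ∈ A'.cells 0 := by
  induction w generalizing x with
  | nil => exact hx
  | cons a w ih => exact ih (mv_mem hp hs hw.1) hw.2

theorem IsElevation.exists_walkIn (hp : p.IsCovering) (hs : X.WeaklySpecial)
    (h : IsElevation p A A') {x y : U.Cell 0} (hx : x ∈ A'.cells 0) (hy : y ∈ A'.cells 0) :
    ∃ w, (hp.squareSystem hs).WalkIn (A'.edges p) x w ∧ (hp.squareSystem hs).dest x w = y := by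
  obtain ⟨z, hz, rfl⟩ := h
  rw [mem_component_zero] at hx hy
  obtain ⟨l, h1, h2⟩ := hx.2.symm.trans hy.2
  refine ⟨l.map p.label, ?_, (isWalk_of_isPath hp hs h1).2⟩
  have hx := hx.2
  clear hy
  induction l generalizing x with
  | nil => trivial
  | cons e l ih =>
    obtain ⟨rfl, h1⟩ := h1
    have he := h2 e (by simp)
    have hm : (hp.squareSystem hs).mv (U.source e) (p.label e) = U.target e := hp.move_eq hs e
    have ht := hx.trans (joined_of_edge he)
    refine ⟨⟨e, mem_component_iff.2 ⟨he, hx⟩, rfl, rfl⟩, ?_⟩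
    rw [hm]
    exact ih ⟨((preimage p A).face_mem _ he : U.target e ∈ _), ht⟩ h1
      (fun f hf => h2 f (by simp [hf])) ht

/-- Elevations of the same subcomplex that share a vertex are equal. -/
theorem IsElevation.mem_stabilizer (h : IsElevation p A A') (g : p.deck) {y : U.Cell 0}
    (hy : y ∈ A'.cells 0) (hgy : g.1 0 y ∈ A'.cells 0) : g ∈ A'.stabilizer p := by
  obtain ⟨x, hx, rfl⟩ := h
  have key : ∀ (g : p.deck) {y : U.Cell 0}, y ∈ ((preimage p A).component x).cells 0 →
      g.1 0 y ∈ ((preimage p A).component x).cells 0 → ∀ (n : ℕ) (c : U.Cell n),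
      c ∈ ((preimage p A).component x).cells n →
        g.1 n c ∈ ((preimage p A).component x).cells n := by
    intro g y hy hgy n c hc
    rw [mem_component_zero] at hy hgy
    rw [mem_component_iff] at hc ⊢
    have hmem : ∀ {m : ℕ} {d : U.Cell m}, d ∈ (preimage p A).cells m →
        g.1 m d ∈ (preimage p A).cells m := by
      intro m d hd
      change p.map (g.1 m d) ∈ A.cells m
      rw [g.2.2]
      exact hd
    obtain ⟨l, h1, h2⟩ := hy.2.symm.trans hc.2
    refine ⟨hmem hc.1, hgy.2.trans ⟨l.map (g.1 1), ?_, ?_⟩⟩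
    · rw [corner, Hom.deck_vertex g.2]
      exact Hom.deck_isPath g.2 h1
    · intro e he
      obtain ⟨f, hf, rfl⟩ := List.mem_map.1 he
      exact hmem (h2 f hf)
  intro n c
  refine ⟨fun hc => ?_, key g hy hgy n c⟩
  have := key g⁻¹ hgy (by simpa using hy) n _ hc
  simpa using this

/-! ### Projections -/

theorem IsProjection.unique {x y z : U.Cell 0} (h : A'.IsProjection x y)
    (h' : A'.IsProjection x z) : y = z := by
  by_contra hne
  exact lt_asymm (h.2 z h'.1 (Ne.symm hne)) (h'.2 y h.1 hne)

theorem IsProjection.deck {g : p.deck} (hg : g ∈ A'.stabilizer p) {x y : U.Cell 0}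
    (h : A'.IsProjection x y) : A'.IsProjection (g.1 0 x) (g.1 0 y) := by
  refine ⟨(hg 0 y).2 h.1, fun z hz hne => ?_⟩
  obtain ⟨z, rfl⟩ := (g.1 0).surjective z
  rw [Hom.deck_dist g.2, Hom.deck_dist g.2]
  exact h.2 z ((hg 0 z).1 hz) fun h => hne (h ▸ rfl)

section

variable (hp : p.IsCovering) (hs : X.WeaklySpecial)

/-- A geodesic that ends at a closest vertex of a subcomplex ends at a gate. -/
theorem gate_of_dist_le (hU : U.SimplyConnected) {b : U.Cell 0} {w : List X.Hyperplane}
    (hw : (hp.squareSystem hs).IsWalk b w) (hr : (hp.squareSystem hs).Reduced b w)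
    (hmin : ∀ z ∈ A'.cells 0, U.dist b ((hp.squareSystem hs).dest b w) ≤ U.dist b z) :
    (hp.squareSystem hs).Gate (A'.edges p) ((hp.squareSystem hs).dest b w) w.reverse := by
  intro h hh hf
  obtain ⟨r, he⟩ := SquareSystem.front_iff.1 hf
  have h1 := he.isWalk hw.reverse.1
  have h2 := ((hr.reverse hw).eqv he).tail
  have h3 := he.dest_eq
  rw [hw.reverse.2, SquareSystem.dest] at h3
  have h4 := dist_eq hp hs hU h1.2.reverse.1 (h2.reverse h1.2)
  rw [h1.2.reverse.2, ← h3] at h4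
  have h5 := hmin _ (mv_mem hp hs hh)
  rw [dist_eq hp hs hU hw hr, h4] at h5
  have h6 := he.length_eq
  simp only [List.length_reverse, List.length_cons] at h5 h6
  omega

theorem IsElevation.isProjection_of_gate (hU : U.SimplyConnected) (hA : A.LocallyConvex)
    (h : IsElevation p A A') {b : U.Cell 0} {w : List X.Hyperplane}
    (hw : (hp.squareSystem hs).IsWalk b w) (hr : (hp.squareSystem hs).Reduced b w)
    (hc : (hp.squareSystem hs).dest b w ∈ A'.cells 0)
    (hg : (hp.squareSystem hs).Gate (A'.edges p) ((hp.squareSystem hs).dest b w) w.reverse) :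
    A'.IsProjection b ((hp.squareSystem hs).dest b w) := by
  refine ⟨hc, fun z hz hne => ?_⟩
  have hT := locallyConvex_edges hp hs (h.locallyConvex hA)
  obtain ⟨q, hq, rfl⟩ := h.exists_walkIn hp hs hc hz
  obtain ⟨v, h1, h2, h3⟩ := hT.exists_reduced hg (hr.reverse hw) hq
  have h4 : (hp.squareSystem hs).IsWalk _ (v ++ w.reverse) :=
    SquareSystem.isWalk_append.2 ⟨hT.isWalk h1, by rw [h2]; exact hw.reverse.1⟩
  have h5 := dist_eq hp hs hU h4.reverse.1 (h3.reverse h4)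
  rw [h4.reverse.2, SquareSystem.dest_append, h2, hw.reverse.2] at h5
  rw [dist_eq hp hs hU hw hr, h5]
  rcases v with _ | ⟨a, v⟩
  · exact absurd h2 hne
  · simp only [List.reverse_append, List.length_append, List.length_reverse, List.length_cons]
    omega

theorem IsElevation.exists_isProjection (hp : p.IsCovering) (hs : X.WeaklySpecial)
    (hU : U.SimplyConnected) (hA : A.LocallyConvex) (h : IsElevation p A A')
    (b : U.Cell 0) : ∃ c, A'.IsProjection b c := by
  obtain ⟨c, hc, hmin⟩ := exists_minimalFor_of_wellFoundedLT (· ∈ A'.cells 0) (U.dist b) h.nonempty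
  obtain ⟨w, hw, rfl, hr⟩ := exists_reduced_walk hp hs hU b c
  refine ⟨_, h.isProjection_of_gate hp hs hU hA hw hr hc
    (gate_of_dist_le hp hs hU hw hr fun z hz => ?_)⟩
  exact (le_total _ _).elim id (hmin hz)

/-- The bridges from any two vertices of the projection of `B'` to `A'` carry the same labels. -/
theorem exists_common_walk (hU : U.SimplyConnected)
    (hA : A.LocallyConvex) (hB : B.LocallyConvex) (hA' : IsElevation p A A')
    (hB' : IsElevation p B B') {b b' c c' : U.Cell 0} (hb : b ∈ B'.cells 0)
    (hb' : b' ∈ B'.cells 0) (hc : A'.IsProjection b c) (hc' : A'.IsProjection b' c') :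
    ∃ w, (hp.squareSystem hs).IsWalk c w ∧ (hp.squareSystem hs).dest c w ∈ B'.cells 0 ∧
      (hp.squareSystem hs).dest c' w ∈ B'.cells 0 := by
  have hTA := locallyConvex_edges hp hs (hA'.locallyConvex hA)
  have hTB := locallyConvex_edges hp hs (hB'.locallyConvex hB)
  obtain ⟨w, hw, rfl, hr⟩ := exists_reduced_walk hp hs hU b c
  have hg := gate_of_dist_le (A' := A') hp hs hU hw hr fun z hz => by
    by_cases hz' : z = (hp.squareSystem hs).dest b w
    · rw [hz']
    · exact (hc.2 z hz hz').le
  obtain ⟨w₀, w₁, hbr⟩ :=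
    SquareSystem.Bridge.exists_of_gate (B := B'.edges p) hw rfl hr hg
  obtain ⟨q, hq, rfl⟩ := hB'.exists_walkIn hp hs hb hb'
  obtain ⟨c₁, w₂, hbr', hc₁⟩ := hbr.walk hTA hTB (P := (· ∈ A'.cells 0))
    (fun x a _ h => mv_mem hp hs h) hc.1 hq
  have hproj := hA'.isProjection_of_gate hp hs hU hA (hbr'.isWalk_append hTB) hbr'.reduced
    (by rw [hbr'.dest_append]; exact hc₁) (by rw [hbr'.dest_append]; exact hbr'.gate_left)
  rw [hbr'.dest_append] at hproj
  obtain rfl := hproj.unique hc'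
  obtain ⟨k1, k2⟩ := hbr.isWalk.reverse
  obtain ⟨-, k4⟩ := hbr'.isWalk.reverse
  rw [hbr.dest_eq] at k1 k2
  rw [hbr'.dest_eq] at k4
  refine ⟨w₀.reverse, k1, ?_, ?_⟩
  · rw [k2]
    exact mem_of_walkIn hp hs hb hbr.walkIn
  · rw [k4]
    exact mem_of_walkIn hp hs hb' hbr'.walkIn

/-- A deck transformation that moves a vertex of the projection of `B'` to `A'` to another such
vertex preserves both `A'` and `B'`. -/
theorem mem_stabilizer_of_isProjection (hp : p.IsCovering) (hs : X.WeaklySpecial)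
    (hU : U.SimplyConnected)
    (hA : A.LocallyConvex) (hB : B.LocallyConvex) (hA' : IsElevation p A A')
    (hB' : IsElevation p B B') (g : p.deck) {c : U.Cell 0}
    (hc : c ∈ (A'.projection B').cells 0) (hgc : g.1 0 c ∈ (A'.projection B').cells 0) :
    g ∈ A'.stabilizer p ⊓ B'.stabilizer p := by
  obtain ⟨hcA, b, hb, h⟩ := hc
  obtain ⟨hgcA, b', hb', h'⟩ := hgc
  have h0 := h fun _ => false
  have h0' := h' fun _ => false
  rw [vertex_cell_zero, vertex_cell_zero] at h0 h0'
  obtain ⟨w, h1, h2, h3⟩ := exists_common_walk hp hs hU hA hB hA' hB' hb hb' h0 h0'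
  refine ⟨hA'.mem_stabilizer g hcA hgcA, hB'.mem_stabilizer g h2 ?_⟩
  rw [Hom.deck_dest hp hs g.2 h1]
  exact h3

end

theorem stabilizer_inf_le :
    A'.stabilizer p ⊓ B'.stabilizer p ≤ (A'.projection B').stabilizer p := by
  have key : ∀ g ∈ A'.stabilizer p ⊓ B'.stabilizer p, ∀ (n : ℕ) (c : U.Cell n),
      c ∈ (A'.projection B').cells n → g.1 n c ∈ (A'.projection B').cells n := by
    rintro g ⟨hgA, hgB⟩ n c ⟨hc, b, hb, h⟩
    refine ⟨(hgA n c).2 hc, g.1 n b, (hgB n b).2 hb, fun v => ?_⟩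
    rw [Hom.deck_vertex g.2, Hom.deck_vertex g.2]
    exact (h v).deck hgA
  intro g hg n c
  refine ⟨fun h => ?_, key g hg n c⟩
  simpa using key g⁻¹ (inv_mem hg) n _ h

end Subcomplex

end CubeComplex

/-! ### Stabilizer and quotient of the projection -/

open CubeComplex CubeComplex.Subcomplex

theorem proposition3p6 (X : CubeComplex.{u}) (hX : X.Connected) (hs : X.WeaklySpecial)
    (U : CubeComplex.{v}) (p : CubeComplex.Hom U X) (hp : p.IsUniversalCover)
    (A B : X.Subcomplex) (hA : A.LocallyConvex) (hB : B.LocallyConvex)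
    (A' B' : U.Subcomplex)
    (hA' : CubeComplex.Subcomplex.IsElevation p A A')
    (hB' : CubeComplex.Subcomplex.IsElevation p B B') :
    (A'.projection B').stabilizer p = A'.stabilizer p ⊓ B'.stabilizer p ∧
      ((A'.projection B').quotientMap p).IsEmbedding := by
  obtain ⟨hc, hU⟩ := hp
  refine ⟨le_antisymm (fun g hg => ?_) stabilizer_inf_le, fun n => ?_⟩
  · obtain ⟨b, hb⟩ := hB'.nonempty
    obtain ⟨c, h⟩ := hA'.exists_isProjection hc hs hU hA b
    have hmem : c ∈ (A'.projection B').cells 0 := by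
      refine ⟨h.1, b, hb, fun v => ?_⟩
      rw [vertex_cell_zero, vertex_cell_zero]
      exact h
    exact mem_stabilizer_of_isProjection hc hs hU hA hB hA' hB' g hmem ((hg 0 c).2 hmem)
  · rintro ⟨c, hcC⟩ ⟨d, hdC⟩ h
    change p.map c = p.map d at h
    obtain ⟨g, hg, hgc⟩ := exists_deck hc hs hU (x := U.corner c) (y := U.corner d)
      (by rw [p.map_corner, h, p.map_corner])
    have hcd : g n c = d := by
      refine hc.eq_of_corner ?_ ((hg.2 c).trans h)
      rw [← hgc]
      exact Hom.deck_vertex hg c _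
    refine Quot.sound ⟨⟨g, hg⟩, stabilizer_inf_le ?_, hcd⟩
    refine mem_stabilizer_of_isProjection hc hs hU hA hB hA' hB' ⟨g, hg⟩ (corner_mem hcC) ?_
    change g 0 (U.corner c) ∈ _
    rw [hgc]
    exact corner_mem hdC
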